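/- **Setting.** For each sample size $T$ we observe a panel $x_{j,t}=f_{j,t}+\varepsilon_{j,t}$, $1\le t\le T$, $1\le j\le n$, where $n$, the deterministic signals $f_{j,t}$, the noise and the probability space may all depend on $T$. There is a single change-point $\eta_1$, $1<\eta_1<T$: every $f_{j,\cdot}$ is constant on $[1,\eta_1]$ and on $[\eta_1+1,T]$; put $\delta_j=f_{j,\eta_1+1}-f_{j,\eta_1}$, $\Pi_1=\{j:\delta_j\ne0\}$, $m_1=|\Pi_1|\ge1$ and $\widetilde\delta_1=m_1^{-1}\sum_{j\in\Pi_1}|\delta_j|$. Fix $\varphi\in[0,1]$. **Assumptions**, with fixed constants $C_\varepsilon,C_\alpha>0$, $\mu\in(0,1)$, $\sigma^*\ge\sigma_*>0$, $\omega\ge0$, $\bar f>0$, $c>0$, $\beta\in(0,1]$ (the conditions are required for all large $T$): - (A1) Each $\{\varepsilon_{j,t}\}_{t\in\mathbb Z}$ is a stationary zero-mean process with finite moments of all orders such that $\mathbb E(\varepsilon_{j,t}^k)\le C_\varepsilon^{k-2}k!\,\mathbb E(\varepsilon_{j,t}^2)$ for all $k\ge3$; its strong mixing coefficients $\alpha_j(k)=\sup|\mathbb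 P(H\cap G)-\mathbb P(H)\mathbb P(G)|$, with the supremum over $t\in\mathbb Z$, $G\in\sigma(\varepsilon_{j,s}:s\ge t+k)$ and $H\in\sigma(\varepsilon_{j,s}:s\le t)$, satisfy $\alpha_j(k)\le C_\alpha\mu^k$ for all $k\ge1$; and its long-run variance $\sigma_j^2=\sum_{k\in\mathbb Z}\mathrm{Cov}(\varepsilon_{j,0},\varepsilon_{j,k})$ satisfies $\sigma_*^2\le\sigma_j^2\le\sigma^{*2}$. (Stationarity to second order suffices. Nothing is assumed on the cross-sectional dependence.) - (A2) $n$ is of exact order $T^\omega$. - (A3) $|f_{j,t}|\le\bar f$ for all $1\le j\le n$, $1\le t\le T$. - (A4) $\min(\eta_1,T-\eta_1)>cT^\beta$. - (A5) $(n^\varphi\log T)^{-1}m_1^\varphi\widetilde\delta_1T^{\beta/2}\to\infty$ as $T\to\infty$. - (A6) The estimators $\widehat\sigma_j^2$ of $\sigma_j^2$ are random variables with $\mathbb P\{\max_{1\le j\le n}|\widehat\sigma_j^2-\sigma_j^2|\le\sigma_*^2/2\}\to1$ as $T\to\infty$. **Statistics.** Let $$\mathcal X^j_b=\sqrt{\tfrac{T-b}{Tb}}\sum_{t=1}^b\frac{x_{j,t}}{\widehat\sigma_j}-\sqrt{\tfrac{b}{T(T-b)}}\sum_{t=b+1}^T\frac{x_{j,t}}{\widehat\sigma_j},\qquad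 1\le b<T,$$ let $|\mathcal X^{(1)}_b|\ge\dots\ge|\mathcal X^{(n)}_b|$ be the ordered moduli of $\mathcal X^1_b,\dots,\mathcal X^n_b$, and for $1\le m\le n$ let $$\mathcal D^\varphi_m(b)=\Big\{\frac{m(2n-m)}{2n}\Big\}^\varphi\Big(\frac1m\sum_{j=1}^m|\mathcal X^{(j)}_b|-\frac1{2n-m}\sum_{j=m+1}^n|\mathcal X^{(j)}_b|\Big).$$ Fix $C>0$, put $d_T=\lfloor C\log^2T\rfloor$ and $B_T=[1,T]\setminus([1,d_T]\cup[T-d_T,T])$ (integers), and let $$\mathcal T^\varphi=\max_{b\in B_T}\max_{1\le m\le n}\mathcal D^\varphi_m(b),\qquad \widehat\eta_1=\arg\max_{b\in B_T}\max_{1\le m\le n}\mathcal D^\varphi_m(b)$$ (any maximiser if there are ties). **Theorem.** There exist constants $C''>0$ and $c_0>0$, depending only on $\varphi,C,C_\varepsilon,C_\alpha,\mu,\sigma_*,\sigma^*,\omega,\bar f,c,\beta$, such that for every panel as above, every $C'>0$ and every test criterion $\pi_{n,T}$ with $C'n^\varphi\log T<\pi_{n,T}<C''m_1^\varphi\widetilde\delta_1T^{\beta/2}$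 for all large $T$, $$\mathbb P\big\{\mathcal T^\varphi>\pi_{n,T}\ \text{and}\ |\widehat\eta_1-\eta_1|<c_0\epsilon_T\big\}\to1\quad(T\to\infty),\qquad \epsilon_T=n^{2\varphi}(m_1^\varphi\widetilde\delta_1)^{-2}\log^2T.$$ -/

import Mathlib

open MeasureTheory ProbabilityTheory Filter Topology Asymptotics

noncomputable section

namespace DoubleCusum

/-! ### The statistics -/

/-- The CUSUM operator `𝒞_b` applied to `{x_t}_{t=s}^e`, for `s ≤ b < e`. -/
def cusum (x : ℕ → ℝ) (s b e : ℕ) : ℝ :=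
  Real.sqrt (((e : ℝ) - b) / (((e : ℝ) - s + 1) * ((b : ℝ) - s + 1))) *
      ∑ t ∈ Finset.Icc s b, x t
    - Real.sqrt (((b : ℝ) - s + 1) / (((e : ℝ) - s + 1) * ((e : ℝ) - b))) *
      ∑ t ∈ Finset.Icc (b + 1) e, x t

/-- The modulus `|𝒳^j_{s,b,e}|` of the CUSUM statistic of the `j`-th series, scaled by `√(V j)`. -/
def absCusum {n : ℕ} (V : Fin n → ℝ) (x : Fin n → ℕ → ℝ) (s b e : ℕ) (j : Fin n) : ℝ :=
  |cusum (fun t => x j t / Real.sqrt (V j)) s b e|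

/-- The entries of `a` in decreasing order (`Tuple.sort a` sorts increasingly). -/
def ordered {n : ℕ} (a : Fin n → ℝ) (j : Fin n) : ℝ :=
  a (Tuple.sort a j.rev)

/-- The double CUSUM operator `𝒟^φ_m`, which orders its input decreasingly. With the index type
`Fin n`, the first `m` coordinates are those with `j.val < m`. -/
def dcOperator {n : ℕ} (φ : ℝ) (m : ℕ) (a : Fin n → ℝ) : ℝ :=
  ((m : ℝ) * (2 * n - m) / (2 * n)) ^ φ *
    ((1 / (m : ℝ)) * ∑ j : Fin n with j.val < m, ordered a j
      - (1 / (2 * (n : ℝ) - m)) * ∑ j : Fin n with m ≤ j.val, ordered a j)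

/-- `max_{1 ≤ m ≤ n} 𝒟^φ_m` of the CUSUM statistics over `[1, T]` at the location `b`. -/
def dcProfile {n : ℕ} (φ : ℝ) (V : Fin n → ℝ) (x : Fin n → ℕ → ℝ) (T b : ℕ) : ℝ :=
  ⨆ m : Set.Icc 1 n, dcOperator φ (m : ℕ) (absCusum V x 1 b T)

/-- The trimming length `d_T = [C log² T]`. -/
def trim (C : ℝ) (T : ℕ) : ℕ := ⌊C * Real.log T ^ 2⌋₊

/-- The search range `[1, T] ∖ ([1, d_T] ∪ [T - d_T, T])`. -/
def searchRange (C : ℝ) (T : ℕ) : Set ℕ :=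
  Set.Icc 1 T \ (Set.Icc 1 (trim C T) ∪ {b : ℕ | (T : ℝ) - trim C T ≤ b ∧ b ≤ T})

/-- The test statistic `𝒯^φ_{1,T}`: the maximum of the profile over the search range. -/
def testStat {n : ℕ} (φ C : ℝ) (V : Fin n → ℝ) (x : Fin n → ℕ → ℝ) (T : ℕ) : ℝ :=
  ⨆ b : searchRange C T, dcProfile φ V x T b

/-- The set of maximisers of the profile over the search range, i.e. the possible values of the
change-point estimator (there may be ties). -/
def argmaxSet {n : ℕ} (φ C : ℝ) (V : Fin n → ℝ) (x : Fin n → ℕ → ℝ) (T : ℕ) : Set ℕ :=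
  {b | b ∈ searchRange C T ∧ ∀ b' ∈ searchRange C T, dcProfile φ V x T b' ≤ dcProfile φ V x T b}

/-! ### The signal -/

/-- The jump `δ_j = f_{j,η+1} - f_{j,η}`. -/
def jump {n : ℕ} (f : Fin n → ℕ → ℝ) (η : ℕ) (j : Fin n) : ℝ := f j (η + 1) - f j η

open Classical in
/-- The set `Π` of coordinates with a non-zero jump at `η`. -/
def changeSet {n : ℕ} (f : Fin n → ℕ → ℝ) (η : ℕ) : Finset (Fin n) :=
  Finset.univ.filter fun j => jump f η j ≠ 0

/-- The number `m₁ = |Π|` of changing coordinates. -/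
def numChange {n : ℕ} (f : Fin n → ℕ → ℝ) (η : ℕ) : ℕ := (changeSet f η).card

/-- The average jump size `δ̃₁`. -/
def avgJump {n : ℕ} (f : Fin n → ℕ → ℝ) (η : ℕ) : ℝ :=
  (numChange f η : ℝ)⁻¹ * ∑ j ∈ changeSet f η, |jump f η j|

/-- The signals are constant on `[1, η]` and on `[η + 1, T]`, and at least one of them jumps
at `η`, where `1 < η < T`. -/
structure IsSingleChange {n : ℕ} (T : ℕ) (f : Fin n → ℕ → ℝ) (η : ℕ) : Prop where
  one_lt : 1 < η
  lt_T : η < T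
  const_left : ∀ j, ∀ t ∈ Set.Icc 1 η, f j t = f j η
  const_right : ∀ j, ∀ t ∈ Set.Icc (η + 1) T, f j t = f j (η + 1)
  one_le_numChange : 1 ≤ numChange f η

/-! ### The noise -/

section Noise

variable {Ω : Type*} [MeasurableSpace Ω]

/-- The σ-algebra generated by `(ε_s)_{s ≤ t}`. -/
abbrev past (ε : ℤ → Ω → ℝ) (t : ℤ) : MeasurableSpace Ω :=
  ⨆ s ∈ Set.Iic t, MeasurableSpace.comap (ε s) (borel ℝ)

/-- The σ-algebra generated by `(ε_s)_{s ≥ t}`. -/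
abbrev future (ε : ℤ → Ω → ℝ) (t : ℤ) : MeasurableSpace Ω :=
  ⨆ s ∈ Set.Ici t, MeasurableSpace.comap (ε s) (borel ℝ)

/-- The strong mixing coefficient `α(k)` (the supremum is also over `t`; for a strictly stationary
process every `t` gives the same value). -/
def mixingCoeff (P : Measure Ω) (ε : ℤ → Ω → ℝ) (k : ℕ) : ℝ :=
  sSup {a : ℝ | ∃ (t : ℤ) (G H : Set Ω), MeasurableSet[future ε (t + k)] G ∧
    MeasurableSet[past ε t] H ∧ a = |P.real (H ∩ G) - P.real H * P.real G|}

/-- The long-run variance `∑_{k ∈ ℤ} Cov(ε_0, ε_k)` of a stationary process. -/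
def longRunVar (P : Measure Ω) (ε : ℤ → Ω → ℝ) : ℝ :=
  ∑' k : ℤ, cov[ε 0, ε k; P]

/-- The conditions on each of the noise processes `ε_j`. Stationarity is required only up to second
order, which a strictly stationary square-integrable process satisfies. -/
structure NoiseCondition {n : ℕ} (P : Measure Ω) (ε : Fin n → ℤ → Ω → ℝ)
    (Cε Cα μ σlo σhi : ℝ) : Prop where
  measurable : ∀ j t, Measurable (ε j t)
  integrable_pow : ∀ j t (k : ℕ), Integrable (fun ω => ε j t ω ^ k) P
  mean_zero : ∀ j t, ∫ ω, ε j t ω ∂P = 0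
  stationary : ∀ j s t h, cov[ε j (s + h), ε j (t + h); P] = cov[ε j s, ε j t; P]
  moment : ∀ j t (k : ℕ), 3 ≤ k →
    ∫ ω, ε j t ω ^ k ∂P ≤ Cε ^ (k - 2) * (k.factorial : ℝ) * ∫ ω, ε j t ω ^ 2 ∂P
  mixing : ∀ j (k : ℕ), 1 ≤ k → mixingCoeff P (ε j) k ≤ Cα * μ ^ k
  lrv_lower : ∀ j, σlo ^ 2 ≤ longRunVar P (ε j)
  lrv_upper : ∀ j, longRunVar P (ε j) ≤ σhi ^ 2

/-- The observed panel `x_{j,t} = f_{j,t} + ε_{j,t}`. -/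
def panel {n : ℕ} (f : Fin n → ℕ → ℝ) (ε : Fin n → ℤ → Ω → ℝ) (ω : Ω) (j : Fin n) (t : ℕ) : ℝ :=
  f j t + ε j (t : ℤ) ω

end Noise

/-- The rate `ε_T = n^{2φ} (m₁^φ δ̃₁)^{-2} log² T`. -/
def rate {n : ℕ} (φ : ℝ) (f : Fin n → ℕ → ℝ) (η T : ℕ) : ℝ :=
  (n : ℝ) ^ (2 * φ) * (((numChange f η : ℝ) ^ φ * avgJump f η) ^ 2)⁻¹ * Real.log T ^ 2

end DoubleCusum

end

noncomputable section

namespace DoubleCusum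

/-! ### Exponential moments -/

section ExpMoment

variable {Ω : Type*} [MeasurableSpace Ω] {P : Measure Ω}

/-! Off one event of vanishing probability the argument is deterministic. On that event, `noiseBad`,
some noise series has a segment of length L ≥ κ log² T whose sum exceeds K √L log T. To bound one
segment, split it into about A log T residue classes modulo p ≈ A log T. Neighbours in a class are p
apart, so the mixing error μ^p is a high negative power of T. Conditionally on the past, truncated
exponentials then have almost their unconditional mean, and a Chernoff bound applies
(`prob_le_prod_le`, `exists_segment_bound`). A union bound over series and endpoints follows, which
is why no cross-sectional assumption is needed.

The maximum over m of the double CUSUM operators is a maximum over coordinate sets S of functionals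
that are linear in the vector of moduli, with coefficients of total absolute size at most 2n^φ.
Testing with S the set of changing coordinates shows that the profile at η is at least of order hΔ,
where h = √(η(T-η)/T) and Δ = m₁^φ δ̃₁, since (A5) makes the noise a small fraction of this
(`dcMax_ge`). This is detection.

For localisation, bounding the noise at b and at η separately is too crude. Instead a factor r,
common to all series, makes CUSUM(b) - r CUSUM(η) free of signal. What remains is a noise bridge of
size at most 3yK log T, while 1 - r ≥ y²/2 (`exists_contraction`). Applied to all coordinates
(`dcMax_le`), this gives D(b) ≤ r D(η) + O(y n^φ log T). At a maximiser b the gain y² D(η) cannot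
beat the linear term in y, so yhΔ is O(n^φ log T). Since y²h² ≥ min(|b-η|, η, T-η)/2, and (A5)
excludes that η or T-η attains this minimum, |b-η| has the claimed order. -/

theorem sq_integral_sq_le [IsProbabilityMeasure P] {X : Ω → ℝ}
    (hint : ∀ k : ℕ, Integrable (fun ω => X ω ^ k) P) :
    (∫ ω, X ω ^ 2 ∂P) ^ 2 ≤ ∫ ω, X ω ^ 4 ∂P := by
  set v := ∫ ω, X ω ^ 2 ∂P with hv
  have h0 : 0 ≤ ∫ ω, (X ω ^ 2 - v) ^ 2 ∂P := integral_nonneg fun ω => sq_nonneg _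
  have h1 : ∫ ω, (X ω ^ 2 - v) ^ 2 ∂P = ∫ ω, X ω ^ 4 ∂P - v ^ 2 := by
    have : ∀ ω, (X ω ^ 2 - v) ^ 2 = X ω ^ 4 - (2 * v) * X ω ^ 2 + v ^ 2 := fun ω => by ring
    simp_rw [this]
    have hi : Integrable (fun ω => X ω ^ 4 - 2 * v * X ω ^ 2) P :=
      (hint 4).sub ((hint 2).const_mul _)
    rw [integral_add hi (integrable_const _),
      integral_sub (hint 4) ((hint 2).const_mul _), integral_const_mul, ← hv]
    simp
    ring
  linarith

/-- The case k = 4 against (E X²)² ≤ E X⁴: the moment condition alone bounds the variance, so no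
separate variance constant is needed. -/
theorem second_moment_le [IsProbabilityMeasure P] {X : Ω → ℝ} {c : ℝ}
    (hint : ∀ k : ℕ, Integrable (fun ω => X ω ^ k) P)
    (hmom : ∀ k : ℕ, 3 ≤ k →
      ∫ ω, X ω ^ k ∂P ≤ c ^ (k - 2) * (k.factorial : ℝ) * ∫ ω, X ω ^ 2 ∂P) :
    ∫ ω, X ω ^ 2 ∂P ≤ 24 * c ^ 2 := by
  have h1 := sq_integral_sq_le hint
  have h2 := hmom 4 (by norm_num)
  have h3 : 0 ≤ ∫ ω, X ω ^ 2 ∂P := integral_nonneg fun ω => sq_nonneg _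
  norm_num [Nat.factorial] at h2
  by_contra! h
  nlinarith [sq_nonneg c]

/-- Removes odd powers: the moment condition bounds signed odd moments only from above, which is
useless when θ < 0. -/
theorem exp_sub_one_sub_le_cosh (x : ℝ) : Real.exp x - 1 - x ≤ 2 * (Real.cosh x - 1) := by
  rw [Real.cosh_eq]
  have := Real.add_one_le_exp (-x)
  linarith

theorem hasSum_cosh_sub_one (x : ℝ) :
    HasSum (fun k : ℕ => x ^ (2 * (k + 1)) / ((2 * (k + 1)).factorial : ℝ)) (Real.cosh x - 1) := by
  have h := Real.hasSum_cosh x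
  rw [← hasSum_nat_add_iff' 1] at h
  simpa using h

/-- The even moments make the power series geometric with ratio θ²c² ≤ 1/4. Its sum is at most
(4/3)θ²v with v ≤ 24c², hence 32. -/
theorem cosh_moment [IsProbabilityMeasure P] {X : Ω → ℝ} {c θ : ℝ} (hX : Measurable X)
    (hc : 0 < c) (hint : ∀ k : ℕ, Integrable (fun ω => X ω ^ k) P)
    (hmom : ∀ k : ℕ, 3 ≤ k →
      ∫ ω, X ω ^ k ∂P ≤ c ^ (k - 2) * (k.factorial : ℝ) * ∫ ω, X ω ^ 2 ∂P)
    (hθ : |θ| * c ≤ 1 / 2) :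
    Integrable (fun ω => Real.cosh (θ * X ω) - 1) P ∧
      ∫ ω, (Real.cosh (θ * X ω) - 1) ∂P ≤ 32 * c ^ 2 * θ ^ 2 := by
  set v := ∫ ω, X ω ^ 2 ∂P with hv
  have hv0 : 0 ≤ v := integral_nonneg fun ω => sq_nonneg _
  have hv1 : v ≤ 24 * c ^ 2 := second_moment_le hint hmom
  have hθ2 : θ ^ 2 * c ^ 2 ≤ 1 / 4 := by
    have : (|θ| * c) ^ 2 ≤ (1 / 2) ^ 2 := pow_le_pow_left₀ (by positivity) hθ 2
    rw [mul_pow, sq_abs] at this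
    linarith
  set g : ℕ → Ω → ℝ := fun k ω => (θ * X ω) ^ (2 * (k + 1)) / ((2 * (k + 1)).factorial : ℝ)
    with hg
  have hg0 : ∀ k ω, 0 ≤ g k ω := fun k ω =>
    div_nonneg ((even_two_mul _).pow_nonneg _) (by positivity)
  have hgm : ∀ k, Measurable (g k) := fun k => by simp only [hg]; fun_prop
  have hgi : ∀ k, Integrable (g k) P := fun k => by
    simp only [hg, mul_pow]
    exact ((hint _).const_mul _).div_const _
  have hgb : ∀ k, ∫ ω, g k ω ∂P ≤ θ ^ 2 * v * (1 / 4) ^ k := by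
    intro k
    have e : ∫ ω, g k ω ∂P
        = θ ^ (2 * (k + 1)) * (∫ ω, X ω ^ (2 * (k + 1)) ∂P) / ((2 * (k + 1)).factorial : ℝ) := by
      simp only [hg, mul_pow]
      rw [integral_div, integral_const_mul]
    rw [e]
    -- The moment condition starts at order 3; the term k = 0 is the variance itself.
    rcases Nat.eq_zero_or_pos k with rfl | hk
    · norm_num [Nat.factorial]
      rw [← hv]
      nlinarith [mul_nonneg (sq_nonneg θ) hv0]
    · have h1 := hmom (2 * (k + 1)) (by omega)
      rw [show 2 * (k + 1) - 2 = 2 * k by omega] at h1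
      have hf : (0 : ℝ) < ((2 * (k + 1)).factorial : ℝ) := by positivity
      rw [div_le_iff₀ hf]
      have hp : (θ ^ 2 * c ^ 2) ^ k ≤ (1 / 4) ^ k := pow_le_pow_left₀ (by positivity) hθ2 k
      have hθ0 : 0 ≤ θ ^ (2 * (k + 1)) := (even_two_mul _).pow_nonneg _
      calc θ ^ (2 * (k + 1)) * (∫ ω, X ω ^ (2 * (k + 1)) ∂P)
          ≤ θ ^ (2 * (k + 1)) * (c ^ (2 * k) * ((2 * (k + 1)).factorial : ℝ) * v) :=
            mul_le_mul_of_nonneg_left h1 hθ0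
        _ = θ ^ 2 * v * (θ ^ 2 * c ^ 2) ^ k * ((2 * (k + 1)).factorial : ℝ) := by ring
        _ ≤ θ ^ 2 * v * (1 / 4) ^ k * ((2 * (k + 1)).factorial : ℝ) := by gcongr
  have hsum : HasSum (fun k : ℕ => θ ^ 2 * v * (1 / 4 : ℝ) ^ k) (θ ^ 2 * v * (4 / 3)) := by
    have := (hasSum_geometric_of_lt_one (r := (1 / 4 : ℝ)) (by norm_num) (by norm_num)).mul_left
      (θ ^ 2 * v)
    rwa [show (1 - 1 / 4 : ℝ)⁻¹ = 4 / 3 by norm_num] at this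
  have hcosh0 : ∀ ω, 0 ≤ Real.cosh (θ * X ω) - 1 := fun ω => by
    linarith [Real.one_le_cosh (θ * X ω)]
  have hl : ∫⁻ ω, ENNReal.ofReal (Real.cosh (θ * X ω) - 1) ∂P
      ≤ ENNReal.ofReal (θ ^ 2 * v * (4 / 3)) := by
    have e : ∀ ω, ENNReal.ofReal (Real.cosh (θ * X ω) - 1) = ∑' k, ENNReal.ofReal (g k ω) := by
      intro ω
      have hs := hasSum_cosh_sub_one (θ * X ω)
      rw [← hs.tsum_eq, ENNReal.ofReal_tsum_of_nonneg (fun k => hg0 k ω) hs.summable]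
    simp_rw [e]
    rw [lintegral_tsum fun k => (hgm k).ennreal_ofReal.aemeasurable, ← hsum.tsum_eq,
      ENNReal.ofReal_tsum_of_nonneg (fun k => by positivity) hsum.summable]
    refine ENNReal.tsum_le_tsum fun k => ?_
    rw [← ofReal_integral_eq_lintegral_ofReal (hgi k) (Eventually.of_forall (hg0 k))]
    exact ENNReal.ofReal_le_ofReal (hgb k)
  have hm : Measurable fun ω => Real.cosh (θ * X ω) - 1 :=
    (Real.measurable_cosh.comp (hX.const_mul θ)).sub_const 1
  have hcoshi : Integrable (fun ω => Real.cosh (θ * X ω) - 1) P :=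
    ⟨hm.aestronglyMeasurable,
      (hasFiniteIntegral_iff_ofReal (Eventually.of_forall hcosh0)).2
        (hl.trans_lt ENNReal.ofReal_lt_top)⟩
  refine ⟨hcoshi, ?_⟩
  rw [integral_eq_lintegral_of_nonneg_ae (Eventually.of_forall hcosh0) hm.aestronglyMeasurable]
  refine (ENNReal.toReal_le_of_le_ofReal (by positivity) hl).trans ?_
  nlinarith [mul_le_mul_of_nonneg_left hv1 (sq_nonneg θ)]

/-- A centred variable with the moment condition is sub-exponential, with constants that depend
only on the moment constant. -/
theorem exp_moment_le [IsProbabilityMeasure P] {X : Ω → ℝ} {c θ : ℝ} (hX : Measurable X)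
    (hc : 0 < c) (hint : ∀ k : ℕ, Integrable (fun ω => X ω ^ k) P)
    (hmean : ∫ ω, X ω ∂P = 0)
    (hmom : ∀ k : ℕ, 3 ≤ k →
      ∫ ω, X ω ^ k ∂P ≤ c ^ (k - 2) * (k.factorial : ℝ) * ∫ ω, X ω ^ 2 ∂P)
    (hθ : |θ| * c ≤ 1 / 2) :
    Integrable (fun ω => Real.exp (θ * X ω)) P ∧
      ∫ ω, Real.exp (θ * X ω) ∂P ≤ Real.exp (64 * c ^ 2 * θ ^ 2) := by
  obtain ⟨hi, hb⟩ := cosh_moment hX hc hint hmom hθ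
  have hX1 : Integrable X P := by simpa using hint 1
  have hdom : Integrable (fun ω => 2 * (Real.cosh (θ * X ω) - 1) + (1 + θ * X ω)) P :=
    (hi.const_mul 2).add ((integrable_const 1).add (hX1.const_mul θ))
  have hle : ∀ ω, Real.exp (θ * X ω) ≤ 2 * (Real.cosh (θ * X ω) - 1) + (1 + θ * X ω) := fun ω => by
    linarith [exp_sub_one_sub_le_cosh (θ * X ω)]
  have hei : Integrable (fun ω => Real.exp (θ * X ω)) P := by
    refine hdom.mono' (by fun_prop) (Eventually.of_forall fun ω => ?_)
    rw [Real.norm_eq_abs, abs_of_pos (Real.exp_pos _)]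
    exact hle ω
  refine ⟨hei, (integral_mono hei hdom hle).trans ?_⟩
  have e : ∫ ω, (2 * (Real.cosh (θ * X ω) - 1) + (1 + θ * X ω)) ∂P
      = 2 * ∫ ω, (Real.cosh (θ * X ω) - 1) ∂P + 1 := by
    have hl : Integrable (fun ω => 1 + θ * X ω) P := (integrable_const 1).add (hX1.const_mul θ)
    rw [integral_add (hi.const_mul 2) hl, integral_const_mul, integral_add (integrable_const 1) (hX1.const_mul θ),
      integral_const_mul, hmean]
    simp
  rw [e]
  linarith [Real.add_one_le_exp (64 * c ^ 2 * θ ^ 2)]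

end ExpMoment

/-! ### Covariances of events and bounded variables -/

section Past

variable {Ω : Type*}

theorem past_mono (ε : ℤ → Ω → ℝ) {s t : ℤ} (h : s ≤ t) : past ε s ≤ past ε t :=
  biSup_mono fun _ hr => le_trans hr h

theorem measurable_past (ε : ℤ → Ω → ℝ) {s t : ℤ} (h : s ≤ t) : Measurable[past ε t] (ε s) := by
  have h1 : MeasurableSpace.comap (ε s) (borel ℝ) ≤ past ε t :=
    le_iSup₂_of_le s (Set.mem_Iic.2 h) le_rfl
  rw [← BorelSpace.measurable_eq (α := ℝ)] at h1
  exact measurable_iff_comap_le.2 h1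

theorem measurable_future (ε : ℤ → Ω → ℝ) {s t : ℤ} (h : t ≤ s) :
    Measurable[future ε t] (ε s) := by
  have h1 : MeasurableSpace.comap (ε s) (borel ℝ) ≤ future ε t :=
    le_iSup₂_of_le s (Set.mem_Ici.2 h) le_rfl
  rw [← BorelSpace.measurable_eq (α := ℝ)] at h1
  exact measurable_iff_comap_le.2 h1

theorem past_le {mΩ : MeasurableSpace Ω} {ε : ℤ → Ω → ℝ} (hε : ∀ t, Measurable (ε t)) (t : ℤ) :
    past ε t ≤ mΩ := by
  refine iSup₂_le fun s _ => ?_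
  have := (hε s).comap_le
  rwa [BorelSpace.measurable_eq (α := ℝ)] at this

end Past

section Mixing

variable {Ω : Type*} [MeasurableSpace Ω] {P : Measure Ω}

/-- Layer cake: integrate the covariance bound for H and the level sets {φ ≥ s} over s in (0, R].
This passes from mixing of events to bounded variables. -/
theorem setIntegral_le_of_event_cov [IsProbabilityMeasure P] {φ : Ω → ℝ} {R a : ℝ} {H : Set Ω}
    (hφ : Measurable φ) (hφ0 : ∀ ω, 0 ≤ φ ω) (hφR : ∀ ω, φ ω ≤ R) (hR : 0 ≤ R)
    (hcov : ∀ s : ℝ, P.real (H ∩ {ω | s ≤ φ ω}) - P.real H * P.real {ω | s ≤ φ ω} ≤ a) :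
    ∫ ω in H, φ ω ∂P ≤ P.real H * ∫ ω, φ ω ∂P + a * R := by
  have hi : Integrable φ P := by
    refine Integrable.of_bound hφ.aestronglyMeasurable R (Eventually.of_forall fun ω => ?_)
    rw [Real.norm_eq_abs, abs_of_nonneg (hφ0 ω)]
    exact hφR ω
  rw [hi.integral_eq_integral_Ioc_meas_le (M := R) (Eventually.of_forall hφ0)
      (Eventually.of_forall hφR),
    hi.integrableOn.integral_eq_integral_Ioc_meas_le (M := R) (Eventually.of_forall hφ0)
      (Eventually.of_forall hφR)]
  have hanti : ∀ Q : Measure Ω, IsFiniteMeasure Q →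
      IntegrableOn (fun s : ℝ => Q.real {ω | s ≤ φ ω}) (Set.Ioc 0 R) := by
    intro Q _
    rw [← intervalIntegrable_iff_integrableOn_Ioc_of_le hR]
    refine Antitone.intervalIntegrable fun s t hst => measureReal_mono ?_
    exact fun ω (hω : t ≤ φ ω) => hst.trans hω
  have h1 := hanti (P.restrict H) inferInstance
  have h2 := (hanti P inferInstance).const_mul (P.real H)
  have h3 : IntegrableOn (fun _ : ℝ => a) (Set.Ioc 0 R) := by simp
  have h4 : ∫ s in Set.Ioc 0 R, (P.restrict H).real {ω | s ≤ φ ω}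
      ≤ ∫ s in Set.Ioc 0 R, (P.real H * P.real {ω | s ≤ φ ω} + a) := by
    refine integral_mono h1 (h2.add h3) fun s => ?_
    have hm : MeasurableSet {ω | s ≤ φ ω} := measurableSet_le measurable_const hφ
    have e : (P.restrict H).real {ω | s ≤ φ ω} = P.real (H ∩ {ω | s ≤ φ ω}) := by
      rw [measureReal_restrict_apply hm, Set.inter_comm]
    have := hcov s
    simp only [e]
    linarith
  refine h4.trans (le_of_eq ?_)
  rw [integral_add h2 h3, integral_const_mul]
  simp [hR, mul_comm]

theorem cov_le_mixingCoeff [IsProbabilityMeasure P] {ε : ℤ → Ω → ℝ} {t : ℤ} {k : ℕ} {G H : Set Ω}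
    (hG : MeasurableSet[future ε (t + k)] G) (hH : MeasurableSet[past ε t] H) :
    |P.real (H ∩ G) - P.real H * P.real G| ≤ mixingCoeff P ε k := by
  refine le_csSup ⟨1, ?_⟩ ⟨t, G, H, hG, hH, rfl⟩
  rintro _ ⟨_, G, H, _, _, rfl⟩
  have h1 : P.real (H ∩ G) ≤ 1 := measureReal_le_one
  have h2 : P.real H ≤ 1 := measureReal_le_one
  have h3 : P.real G ≤ 1 := measureReal_le_one
  have h4 : 0 ≤ P.real (H ∩ G) := measureReal_nonneg
  have h5 : 0 ≤ P.real H := measureReal_nonneg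
  have h6 : 0 ≤ P.real G := measureReal_nonneg
  rw [abs_le]
  constructor <;> nlinarith

end Mixing

/-! ### Products of weakly dependent bounded variables -/

section Product

variable {Ω : Type*}

/-- The exceptional set belongs to `m`, so `hset` can be tested on that very set, as in Markov's
inequality. -/
theorem prob_condExp_gt_le {m mΩ : MeasurableSpace Ω} {P : Measure Ω} [IsProbabilityMeasure P]
    (hm : m ≤ mΩ) {φ : Ω → ℝ} {M a ζ : ℝ} (hφ : Integrable φ P) (hζ : 0 < ζ)
    (hset : ∀ H, MeasurableSet[m] H → ∫ ω in H, φ ω ∂P ≤ P.real H * M + a) :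
    P.real {ω | M + ζ < (P[φ | m]) ω} ≤ a / ζ := by
  set H := {ω | M + ζ < (P[φ | m]) ω} with hH
  have hHm : MeasurableSet[m] H :=
    measurableSet_lt measurable_const stronglyMeasurable_condExp.measurable
  have h1 := hset H hHm
  rw [← setIntegral_condExp hm hφ hHm] at h1
  have h2 : ∫ _ in H, (M + ζ) ∂P ≤ ∫ ω in H, (P[φ | m]) ω ∂P :=
    setIntegral_mono_on (by simp) integrable_condExp.integrableOn (hm _ hHm) fun ω hω => le_of_lt hω
  rw [setIntegral_const, smul_eq_mul] at h2
  rw [le_div_iff₀ hζ]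
  linarith

theorem integral_mul_le_of_condExp_le {m mΩ : MeasurableSpace Ω} {P : Measure Ω} [IsProbabilityMeasure P]
    (hm : m ≤ mΩ) {φ g : Ω → ℝ} {M' B : ℝ} (hφ : Integrable φ P)
    (hg : Measurable[m] g) (hg0 : ∀ ω, 0 ≤ g ω) (hgB : ∀ ω, g ω ≤ B)
    (hle : ∀ ω, g ω ≠ 0 → (P[φ | m]) ω ≤ M') :
    ∫ ω, g ω * φ ω ∂P ≤ M' * ∫ ω, g ω ∂P := by
  have hgm : Measurable g := hg.mono hm le_rfl
  have hgn : ∀ ω, ‖g ω‖ ≤ B := fun ω => by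
    rw [Real.norm_eq_abs, abs_of_nonneg (hg0 ω)]; exact hgB ω
  have hgi : Integrable g P :=
    Integrable.of_bound hgm.aestronglyMeasurable B (Eventually.of_forall hgn)
  have hgφ : Integrable (g * φ) P :=
    hφ.bdd_mul hgm.aestronglyMeasurable (Eventually.of_forall hgn)
  have h1 := condExp_mul_of_stronglyMeasurable_left hg.stronglyMeasurable hgφ hφ
  have h2 : ∫ ω, g ω * φ ω ∂P = ∫ ω, (g * P[φ | m]) ω ∂P := by
    rw [← integral_congr_ae h1, integral_condExp hm]
    rfl
  rw [h2, ← integral_const_mul]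
  refine integral_mono (integrable_condExp.congr h1) (hgi.const_mul M') fun ω => ?_
  simp only [Pi.mul_apply]
  by_cases h : g ω = 0
  · simp [h]
  · rw [mul_comm M']
    exact mul_le_mul_of_nonneg_left (hle ω h) (hg0 ω)

/-- A Chernoff bound for products of bounded variables that are almost independent of the past. -/
theorem prob_le_prod_le {mΩ : MeasurableSpace Ω} {P : Measure Ω} [IsProbabilityMeasure P]
    (F : ℕ → MeasurableSpace Ω) (hF : ∀ i, F i ≤ mΩ) (hFm : Monotone F) {φ : ℕ → Ω → ℝ} {R M a ζ x : ℝ}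
    (q : ℕ) (hφ : ∀ i, Measurable[F (i + 1)] (φ i)) (hφ0 : ∀ i ω, 0 ≤ φ i ω)
    (hφR : ∀ i ω, φ i ω ≤ R) (hM : 0 ≤ M) (hζ : 0 < ζ) (hx : 0 < x)
    (hset : ∀ i H, MeasurableSet[F i] H → ∫ ω in H, φ i ω ∂P ≤ P.real H * M + a) :
    P.real {ω | x ≤ ∏ i ∈ Finset.range q, φ i ω} ≤ x⁻¹ * (M + ζ) ^ q + q * (a / ζ) := by
  classical
  have hφi : ∀ i, Integrable (φ i) P := fun i =>
    Integrable.of_bound ((hφ i).mono (hF _) le_rfl).aestronglyMeasurable R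
      (Eventually.of_forall fun ω => by
        rw [Real.norm_eq_abs, abs_of_nonneg (hφ0 i ω)]; exact hφR i ω)
  -- The rare events where the past predicts `φ i` too well. With each factor set to zero there, the
  -- product gains at most M + ζ in expectation per factor; the events themselves cost a/ζ each.
  set A : ℕ → Set Ω := fun i => {ω | M + ζ < (P[φ i | F i]) ω} with hA
  have hAm : ∀ i, MeasurableSet[F i] (A i) := fun i =>
    measurableSet_lt measurable_const stronglyMeasurable_condExp.measurable
  set W : ℕ → Ω → ℝ := fun k ω => ∏ i ∈ Finset.range k, (A i)ᶜ.indicator (φ i) ω with hW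
  have hind0 : ∀ i ω, 0 ≤ (A i)ᶜ.indicator (φ i) ω := fun i ω =>
    Set.indicator_nonneg (fun ω _ => hφ0 i ω) ω
  have hind1 : ∀ i ω, (A i)ᶜ.indicator (φ i) ω ≤ R := fun i ω =>
    (Set.indicator_le_self' (fun ω _ => hφ0 i ω) ω).trans (hφR i ω)
  have hW0 : ∀ k ω, 0 ≤ W k ω := fun k ω => Finset.prod_nonneg fun i _ => hind0 i ω
  have hWB : ∀ k ω, W k ω ≤ R ^ k := fun k ω => by
    calc W k ω ≤ ∏ i ∈ Finset.range k, R :=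
          Finset.prod_le_prod (fun i _ => hind0 i ω) fun i _ => hind1 i ω
      _ = R ^ k := by simp
  have hWm : ∀ k, Measurable[F k] (W k) := by
    intro k
    refine Finset.measurable_prod _ fun i hi => ?_
    have hik : i + 1 ≤ k := by simpa using hi
    exact ((hφ i).mono (hFm hik) le_rfl).indicator
      ((hFm (i.le_succ.trans hik)) _ (hAm i)).compl
  have hWi : ∀ k, ∫ ω, W k ω ∂P ≤ (M + ζ) ^ k := by
    intro k
    induction k with
    | zero => simp [hW]
    | succ k ih =>
      have e : ∀ ω, W (k + 1) ω = (A k)ᶜ.indicator (W k) ω * φ k ω := fun ω => by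
        simp only [hW, Finset.prod_range_succ]
        by_cases h : ω ∈ (A k)ᶜ <;> simp [h]
      simp_rw [e]
      have hgm : Measurable[F k] ((A k)ᶜ.indicator (W k)) := (hWm k).indicator (hAm k).compl
      have hg0 : ∀ ω, 0 ≤ (A k)ᶜ.indicator (W k) ω := fun ω =>
        Set.indicator_nonneg (fun ω _ => hW0 k ω) ω
      have hgW : ∀ ω, (A k)ᶜ.indicator (W k) ω ≤ W k ω := fun ω =>
        Set.indicator_le_self' (fun ω _ => hW0 k ω) ω
      have hgB : ∀ ω, (A k)ᶜ.indicator (W k) ω ≤ R ^ k := fun ω => (hgW ω).trans (hWB k ω)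
      have h1 : ∫ ω, (A k)ᶜ.indicator (W k) ω * φ k ω ∂P
          ≤ (M + ζ) * ∫ ω, (A k)ᶜ.indicator (W k) ω ∂P := by
        refine integral_mul_le_of_condExp_le (hF k) (hφi k) hgm hg0 hgB fun ω hω => ?_
        have : ω ∈ (A k)ᶜ := Set.mem_of_indicator_ne_zero hω
        simpa [hA] using this
      have hbd : ∀ {g : Ω → ℝ}, Measurable[F k] g → (∀ ω, 0 ≤ g ω) → (∀ ω, g ω ≤ R ^ k) →
          Integrable g P := fun hg h0 hB =>
        Integrable.of_bound (hg.mono (hF k) le_rfl).aestronglyMeasurable (R ^ k)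
          (Eventually.of_forall fun ω => by
            rw [Real.norm_eq_abs, abs_of_nonneg (h0 ω)]; exact hB ω)
      have h2 : ∫ ω, (A k)ᶜ.indicator (W k) ω ∂P ≤ ∫ ω, W k ω ∂P :=
        integral_mono (hbd hgm hg0 hgB) (hbd (hWm k) (hW0 k) (hWB k)) hgW
      calc _ ≤ _ := h1
        _ ≤ (M + ζ) * (M + ζ) ^ k := by
          have : 0 ≤ M + ζ := by linarith
          exact mul_le_mul_of_nonneg_left (h2.trans ih) this
        _ = (M + ζ) ^ (k + 1) := by ring
  have hsub : {ω | x ≤ ∏ i ∈ Finset.range q, φ i ω}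
      ⊆ {ω | x ≤ W q ω} ∪ ⋃ i ∈ Finset.range q, A i := by
    intro ω hω
    by_cases h : ω ∈ ⋃ i ∈ Finset.range q, A i
    · exact Or.inr h
    · left
      simp only [Set.mem_iUnion, not_exists] at h
      have : W q ω = ∏ i ∈ Finset.range q, φ i ω :=
        Finset.prod_congr rfl fun i hi => by
          have := h i hi
          simp [this]
      simpa [this] using hω
  have hmk : P.real {ω | x ≤ W q ω} ≤ x⁻¹ * (M + ζ) ^ q := by
    have hWqi : Integrable (W q) P :=
      Integrable.of_bound ((hWm q).mono (hF q) le_rfl).aestronglyMeasurable (R ^ q)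
        (Eventually.of_forall fun ω => by
          rw [Real.norm_eq_abs, abs_of_nonneg (hW0 q ω)]; exact hWB q ω)
    have h1 := mul_meas_ge_le_integral_of_nonneg (Eventually.of_forall (hW0 q)) hWqi x
    rw [inv_mul_eq_div, le_div_iff₀ hx, mul_comm]
    exact h1.trans (hWi q)
  have hun : P.real (⋃ i ∈ Finset.range q, A i) ≤ q * (a / ζ) := by
    refine (measureReal_biUnion_finset_le _ _).trans ?_
    refine (Finset.sum_le_sum fun i _ =>
      prob_condExp_gt_le (hF i) (hφi i) hζ (hset i)).trans ?_
    simp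
  calc _ ≤ P.real ({ω | x ≤ W q ω} ∪ ⋃ i ∈ Finset.range q, A i) := measureReal_mono hsub
    _ ≤ _ := (measureReal_union_le _ _).trans (add_le_add hmk hun)

end Product

/-! ### Deviation bounds for segment sums of the noise -/

section Segment

variable {Ω : Type*} [MeasurableSpace Ω] {P : Measure Ω} {n : ℕ} {ε : Fin n → ℤ → Ω → ℝ}
  {Cε Cα μ σlo σhi : ℝ}

/-- Truncation at R is needed because strong mixing controls only bounded variables; it also only
lowers the exponential moment. -/
theorem NoiseCondition.setIntegral_trunc_le [IsProbabilityMeasure P]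
    (h : NoiseCondition P ε Cε Cα μ σlo σhi) (hCε : 0 < Cε) (j : Fin n) {t u : ℤ} {p : ℕ}
    (hp : 1 ≤ p) (hu : u = t + p) {θ l R : ℝ} (hθl : |θ| ≤ l) (hl : l * Cε ≤ 1 / 2) (hR : 0 ≤ R)
    {H : Set Ω} (hH : MeasurableSet[past (ε j) t] H) :
    ∫ ω in H, min (Real.exp (θ * ε j u ω)) R ∂P
      ≤ P.real H * Real.exp (64 * Cε ^ 2 * l ^ 2) + Cα * μ ^ p * R := by
  have hm := h.measurable j u
  have hθ : |θ| * Cε ≤ 1 / 2 := le_trans (by gcongr) hl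
  obtain ⟨hi, hb⟩ := exp_moment_le (θ := θ) hm hCε (h.integrable_pow j u) (h.mean_zero j u)
    (h.moment j u) hθ
  have hφm : Measurable fun ω => min (Real.exp (θ * ε j u ω)) R := by fun_prop
  have hφ0 : ∀ ω, 0 ≤ min (Real.exp (θ * ε j u ω)) R := fun ω => le_min (Real.exp_pos _).le hR
  have hfut : Measurable[future (ε j) (t + p)] fun ω => min (Real.exp (θ * ε j u ω)) R :=
    (by fun_prop : Measurable fun z : ℝ => min (Real.exp (θ * z)) R).comp
      (measurable_future (ε j) hu.ge)
  have h1 := setIntegral_le_of_event_cov (P := P) (H := H) (a := Cα * μ ^ p) hφm hφ0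
    (fun ω => min_le_right _ _) hR fun s =>
      ((le_abs_self _).trans (cov_le_mixingCoeff
        (measurableSet_le (@measurable_const _ _ _ (future (ε j) (t + p)) s) hfut) hH)).trans
        (h.mixing j p hp)
  have hφi : Integrable (fun ω => min (Real.exp (θ * ε j u ω)) R) P :=
    hi.mono' hφm.aestronglyMeasurable (Eventually.of_forall fun ω => by
      rw [Real.norm_eq_abs, abs_of_nonneg (hφ0 ω)]; exact min_le_left _ _)
  have h2 : ∫ ω, min (Real.exp (θ * ε j u ω)) R ∂P ≤ Real.exp (64 * Cε ^ 2 * l ^ 2) := by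
    refine (integral_mono hφi hi fun ω => min_le_left _ _).trans (hb.trans (Real.exp_le_exp.2 ?_))
    have : θ ^ 2 ≤ l ^ 2 := sq_le_sq.2 (hθl.trans (le_abs_self l))
    gcongr
  have h3 := mul_le_mul_of_nonneg_left h2 (measureReal_nonneg (μ := P) (s := H))
  linarith

/-- A Chernoff bound for weighted sums along an arithmetic progression with difference `p`. -/
theorem NoiseCondition.prob_progression_le [IsProbabilityMeasure P]
    (h : NoiseCondition P ε Cε Cα μ σlo σhi) (hCε : 0 < Cε)
    (j : Fin n) (s : ℤ) {p : ℕ} (hp : 1 ≤ p) (q : ℕ) {w : ℕ → ℝ} (hw : ∀ i, |w i| ≤ 1)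
    {lam l R ζ : ℝ} (hlam : |lam| = l) (hl : l * Cε ≤ 1 / 2) (hR : 0 < R) (hζ : 0 < ζ) (y : ℝ) :
    P.real {ω | y ≤ lam * ∑ i ∈ Finset.range q, w i * ε j (s + p * i) ω}
      ≤ q * (Real.exp (64 * Cε ^ 2 * l ^ 2) / R)
        + Real.exp (-y) * (Real.exp (64 * Cε ^ 2 * l ^ 2) + ζ) ^ q
        + q * (Cα * μ ^ p * R / ζ) := by
  set M := Real.exp (64 * Cε ^ 2 * l ^ 2) with hM
  set φ : ℕ → Ω → ℝ := fun i ω => min (Real.exp (lam * w i * ε j (s + p * i) ω)) R with hφ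
  -- `F i` ends p steps before the i-th term and `F (i + 1)` ends exactly at it: this gives both the
  -- mixing gap and adaptedness.
  set F : ℕ → MeasurableSpace Ω := fun i => past (ε j) (s + p * i - p) with hF
  have hlw : ∀ i, |lam * w i| ≤ l := fun i => by
    rw [abs_mul, ← hlam]
    exact mul_le_of_le_one_right (abs_nonneg _) (hw i)
  have h1 : P.real {ω | Real.exp y ≤ ∏ i ∈ Finset.range q, φ i ω}
      ≤ (Real.exp y)⁻¹ * (M + ζ) ^ q + q * (Cα * μ ^ p * R / ζ) := by
    refine prob_le_prod_le (R := R) F (fun i => past_le (h.measurable j) _) ?_ q ?_ ?_ ?_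
      (Real.exp_pos _).le hζ (Real.exp_pos _) ?_
    · intro a b hab
      refine past_mono _ ?_
      have : (p : ℤ) * a ≤ p * b := by gcongr
      omega
    · intro i
      refine (by fun_prop : Measurable fun z : ℝ => min (Real.exp (lam * w i * z)) R).comp
        (measurable_past (ε j) ?_)
      push_cast
      linarith
    · exact fun i ω => le_min (Real.exp_pos _).le hR.le
    · exact fun i ω => min_le_right _ _
    · intro i H hH
      exact h.setIntegral_trunc_le hCε j hp (by ring) (hlw i) hl hR.le hH
  have h2 : ∀ i, P.real {ω | R ≤ Real.exp (lam * w i * ε j (s + p * i) ω)} ≤ M / R := by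
    intro i
    have hθ : |lam * w i| * Cε ≤ 1 / 2 := le_trans (by gcongr; exact hlw i) hl
    obtain ⟨hi, hb⟩ := exp_moment_le (θ := lam * w i) (h.measurable j (s + p * i)) hCε
      (h.integrable_pow j _) (h.mean_zero j _) (h.moment j _) hθ
    have h3 := mul_meas_ge_le_integral_of_nonneg
      (Eventually.of_forall fun ω => (Real.exp_pos _).le) hi R
    rw [le_div_iff₀ hR, mul_comm]
    refine h3.trans (hb.trans (Real.exp_le_exp.2 ?_))
    have : (lam * w i) ^ 2 ≤ l ^ 2 := sq_le_sq.2 ((hlw i).trans (le_abs_self l))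
    gcongr
  have hsub : {ω | y ≤ lam * ∑ i ∈ Finset.range q, w i * ε j (s + p * i) ω}
      ⊆ (⋃ i ∈ Finset.range q, {ω | R ≤ Real.exp (lam * w i * ε j (s + p * i) ω)})
        ∪ {ω | Real.exp y ≤ ∏ i ∈ Finset.range q, φ i ω} := by
    intro ω hω
    by_cases hex : ω ∈ ⋃ i ∈ Finset.range q, {ω | R ≤ Real.exp (lam * w i * ε j (s + p * i) ω)}
    · exact Or.inl hex
    · right
      simp only [Set.mem_iUnion, not_exists, Set.mem_ofPred_eq, not_le] at hex
      have e : ∏ i ∈ Finset.range q, φ i ω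
          = Real.exp (lam * ∑ i ∈ Finset.range q, w i * ε j (s + p * i) ω) := by
        rw [Finset.mul_sum, Real.exp_sum]
        refine Finset.prod_congr rfl fun i hi => ?_
        rw [hφ]
        simp only
        rw [min_eq_left (hex i hi).le, mul_assoc]
      rw [Set.mem_ofPred_eq, e]
      exact Real.exp_le_exp.2 hω
  have hun : P.real (⋃ i ∈ Finset.range q, {ω | R ≤ Real.exp (lam * w i * ε j (s + p * i) ω)})
      ≤ q * (M / R) := by
    refine (measureReal_biUnion_finset_le _ _).trans ((Finset.sum_le_sum fun i _ => h2 i).trans ?_)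
    simp
  rw [Real.exp_neg]
  have := (measureReal_mono (μ := P) hsub).trans (measureReal_union_le _ _)
  linarith

theorem sum_range_mul_eq_sum_residues (p q : ℕ) (g : ℕ → ℝ) :
    ∑ u ∈ Finset.range (p * q), g u
      = ∑ r ∈ Finset.range p, ∑ i ∈ Finset.range q, g (p * i + r) := by
  rw [Finset.sum_comm]
  induction q with
  | zero => simp
  | succ q ih => rw [Nat.mul_succ, Finset.sum_range_add, ih, Finset.sum_range_succ]

/-- Pigeonhole over residues modulo p: if the total exceeds x, some class sum is at least x/p. The
factor 2p counts signs and classes. -/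
theorem NoiseCondition.prob_segment_le [IsProbabilityMeasure P]
    (h : NoiseCondition P ε Cε Cα μ σlo σhi) (hCε : 0 < Cε)
    (j : Fin n) (s : ℤ) {p q L : ℕ} (hp : 1 ≤ p) (hL : L ≤ p * q)
    {l R ζ : ℝ} (hl0 : 0 ≤ l) (hl : l * Cε ≤ 1 / 2) (hR : 0 < R) (hζ : 0 < ζ) (x : ℝ) :
    P.real {ω | x < |∑ u ∈ Finset.range L, ε j (s + u) ω|}
      ≤ 2 * p * (q * (Real.exp (64 * Cε ^ 2 * l ^ 2) / R)
        + Real.exp (-(l * (x / p))) * (Real.exp (64 * Cε ^ 2 * l ^ 2) + ζ) ^ q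
        + q * (Cα * μ ^ p * R / ζ)) := by
  set b := q * (Real.exp (64 * Cε ^ 2 * l ^ 2) / R)
        + Real.exp (-(l * (x / p))) * (Real.exp (64 * Cε ^ 2 * l ^ 2) + ζ) ^ q
        + q * (Cα * μ ^ p * R / ζ) with hb
  -- Zero weights pad the segment to length p·q, so that all residue classes have q terms.
  set w : ℕ → ℝ := fun u => if u < L then 1 else 0 with hw
  have hw1 : ∀ u, |w u| ≤ 1 := fun u => by
    simp only [hw]; split_ifs <;> simp
  set S : ℕ → Ω → ℝ := fun r ω =>
    ∑ i ∈ Finset.range q, w (p * i + r) * ε j (s + r + p * i) ω with hS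
  have hp0 : (0 : ℝ) < p := by exact_mod_cast hp
  have hsum : ∀ ω, ∑ u ∈ Finset.range L, ε j (s + u) ω = ∑ r ∈ Finset.range p, S r ω := by
    intro ω
    have e1 : ∑ u ∈ Finset.range L, ε j (s + u) ω
        = ∑ u ∈ Finset.range (p * q), w u * ε j (s + u) ω := by
      rw [← Finset.sum_subset (Finset.range_subset_range.2 hL)]
      · refine Finset.sum_congr rfl fun u hu => ?_
        simp [hw, Finset.mem_range.1 hu]
      · intro u _ hu
        have : ¬ u < L := by simpa using hu
        simp [hw, this]
    rw [e1, sum_range_mul_eq_sum_residues]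
    refine Finset.sum_congr rfl fun r _ => Finset.sum_congr rfl fun i _ => ?_
    congr 2
    push_cast
    ring
  have hE : ∀ lam : ℝ, |lam| = l → ∀ r, P.real {ω | l * (x / p) ≤ lam * S r ω} ≤ b := fun lam hlam r =>
    h.prob_progression_le hCε j (s + r) hp q (fun i => hw1 _) hlam hl hR hζ _
  have key : ∀ (sg : ℝ) ω, x < sg * ∑ r ∈ Finset.range p, S r ω →
      ∃ r ∈ Finset.range p, l * (x / p) ≤ (l * sg) * S r ω := by
    intro sg ω hx
    by_contra! hcon
    have h1 : ∀ r ∈ Finset.range p, sg * S r ω ≤ x / p := by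
      intro r hr
      have := hcon r hr
      rw [mul_assoc] at this
      by_contra! h2
      exact absurd this (not_lt.2 (mul_le_mul_of_nonneg_left h2.le hl0))
    have h2 := Finset.sum_le_sum h1
    rw [← Finset.mul_sum] at h2
    simp only [Finset.sum_const, Finset.card_range, nsmul_eq_mul] at h2
    rw [mul_div_cancel₀ _ hp0.ne'] at h2
    linarith
  have hsub : {ω | x < |∑ u ∈ Finset.range L, ε j (s + u) ω|}
      ⊆ (⋃ r ∈ Finset.range p, {ω | l * (x / p) ≤ l * S r ω})
        ∪ ⋃ r ∈ Finset.range p, {ω | l * (x / p) ≤ -l * S r ω} := by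
    intro ω hω
    rw [Set.mem_ofPred_eq, hsum, lt_abs] at hω
    rcases hω with hω | hω
    · obtain ⟨r, hr, h1⟩ := key 1 ω (by simpa using hω)
      exact Or.inl (Set.mem_biUnion hr (by simpa using h1))
    · obtain ⟨r, hr, h1⟩ := key (-1) ω (by simpa using hω)
      exact Or.inr (Set.mem_biUnion hr (by simpa using h1))
  have hun : ∀ lam : ℝ, |lam| = l →
      P.real (⋃ r ∈ Finset.range p, {ω | l * (x / p) ≤ lam * S r ω}) ≤ p * b := fun lam hlam => by
    refine (measureReal_biUnion_finset_le _ _).trans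
      ((Finset.sum_le_sum fun r _ => hE lam hlam r).trans ?_)
    simp
  have h1 := hun l (abs_of_nonneg hl0)
  have h2 := hun (-l) (by rw [abs_neg, abs_of_nonneg hl0])
  have := (measureReal_mono (μ := P) hsub).trans (measureReal_union_le _ _)
  linarith

end Segment

/-! ### Choice of scales and a noise bound uniform over series and segments -/

theorem sum_Ioc_eq_sum_range_int {a e : ℕ} (h : a ≤ e) (g : ℤ → ℝ) :
    ∑ t ∈ Finset.Ioc a e, g t = ∑ u ∈ Finset.range (e - a), g ((a + 1 : ℤ) + u) := by
  have : Finset.Ioc a e = Finset.Ico (a + 1) (e + 1) := by ext; simp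
  rw [this, Finset.sum_Ico_eq_sum_range]
  refine Finset.sum_congr (by congr 1; omega) fun u _ => ?_
  push_cast
  rfl

theorem eventually_log_ge (c : ℝ) : ∀ᶠ T : ℕ in atTop, c ≤ Real.log T :=
  (Real.tendsto_log_atTop.comp tendsto_natCast_atTop_atTop).eventually_ge_atTop c

theorem eventually_mul_log_pow_le (c : ℝ) (k : ℕ) {b : ℝ} (hb : 0 < b) :
    ∀ᶠ T : ℕ in atTop, c * Real.log T ^ k ≤ (T : ℝ) ^ b := by
  have h0 := (isLittleO_log_rpow_rpow_atTop (k : ℝ) hb).comp_tendsto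
    (tendsto_natCast_atTop_atTop (R := ℝ))
  have h1 := h0.bound (c := (|c| + 1)⁻¹) (by positivity)
  filter_upwards [h1, eventually_log_ge 1] with T hT hl
  simp only [Function.comp_apply, Real.rpow_natCast] at hT
  have hT0 : (0 : ℝ) ≤ (T : ℝ) ^ b := by positivity
  rw [Real.norm_of_nonneg (by positivity), Real.norm_of_nonneg hT0, inv_mul_eq_div,
    le_div_iff₀ (by positivity)] at hT
  have : (0 : ℝ) ≤ Real.log T ^ k := by positivity
  nlinarith [le_abs_self c]

/-- With R = exp(Bl) and ζ = 1/T, the truncation, Chernoff and mixing errors are each O(T²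
exp(-Bl)). In the last one, μ^p ≤ exp(-2Bl) absorbs R. The exponent 18 is 16 from `hq` plus q/T ≤ 2.
-/
theorem segment_bound_arith {D l T Bl Cα μ ADa y : ℝ} {p q : ℕ} (hD : 0 ≤ D) (hT : 1 ≤ T)
    (hpT : (p : ℝ) ≤ T) (hpq : (p : ℝ) * q ≤ 2 * T) (hqT : (q : ℝ) ≤ 2 * T)
    (hCα : 0 ≤ Cα) (hμ0 : 0 ≤ μ) (hDl : D * l ^ 2 ≤ 16) (hy : y = ADa + Bl)
    (hq : q * (D * l ^ 2) ≤ ADa + 16) (hμ : μ ^ p ≤ Real.exp (-Bl) * Real.exp (-Bl)) :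
    2 * p * (q * (Real.exp (D * l ^ 2) / Real.exp Bl)
        + Real.exp (-y) * (Real.exp (D * l ^ 2) + T⁻¹) ^ q
        + q * (Cα * μ ^ p * Real.exp Bl / T⁻¹))
      ≤ (4 * Real.exp 16 + 2 * Real.exp 18 + 4 * Cα) * (T ^ 2 * Real.exp (-Bl)) := by
  have hT0 : 0 < T := by linarith
  have hTT : T ≤ T ^ 2 := by nlinarith
  obtain ⟨E, hE⟩ : ∃ E, E = Real.exp (-Bl) := ⟨_, rfl⟩
  have hE0 : 0 < E := hE ▸ Real.exp_pos _
  have hRE : Real.exp Bl = E⁻¹ := by rw [hE, Real.exp_neg, inv_inv]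
  rw [← hE] at hμ
  rw [hRE, ← hE, div_inv_eq_mul, div_inv_eq_mul]
  have t1 : 2 * (p : ℝ) * (q * (Real.exp (D * l ^ 2) * E)) ≤ 4 * Real.exp 16 * (T ^ 2 * E) := by
    have e1 : Real.exp (D * l ^ 2) ≤ Real.exp 16 := Real.exp_le_exp.2 hDl
    have e2 : (p : ℝ) * q ≤ 2 * T ^ 2 := by linarith
    calc 2 * (p : ℝ) * (q * (Real.exp (D * l ^ 2) * E))
        = 2 * (p * q) * (Real.exp (D * l ^ 2) * E) := by ring
      _ ≤ 2 * (2 * T ^ 2) * (Real.exp 16 * E) := by gcongr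
      _ = _ := by ring
  have t2 : 2 * (p : ℝ) * (Real.exp (-y) * (Real.exp (D * l ^ 2) + T⁻¹) ^ q)
      ≤ 2 * Real.exp 18 * (T ^ 2 * E) := by
    have e2 : Real.exp (D * l ^ 2) + T⁻¹ ≤ Real.exp (D * l ^ 2 + T⁻¹) := by
      have h1 : 1 ≤ Real.exp (D * l ^ 2) := Real.one_le_exp (by positivity)
      have h2 := Real.add_one_le_exp T⁻¹
      have h3 : 0 < T⁻¹ := inv_pos.2 hT0
      rw [Real.exp_add]
      nlinarith
    have e3 : (Real.exp (D * l ^ 2) + T⁻¹) ^ q ≤ Real.exp (q * (D * l ^ 2 + T⁻¹)) := by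
      rw [Real.exp_nat_mul]
      exact pow_le_pow_left₀ (by positivity) e2 q
    have f1 : (q : ℝ) * T⁻¹ ≤ 2 := by
      rw [← div_eq_mul_inv, div_le_iff₀ hT0]; exact hqT
    have e5 : Real.exp (-y) * (Real.exp (D * l ^ 2) + T⁻¹) ^ q ≤ Real.exp 18 * E := by
      refine (mul_le_mul_of_nonneg_left e3 (Real.exp_pos _).le).trans ?_
      rw [← Real.exp_add, hE, ← Real.exp_add, hy]
      exact Real.exp_le_exp.2 (by linarith)
    have e6 : (p : ℝ) ≤ T ^ 2 := hpT.trans hTT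
    calc _ ≤ 2 * T ^ 2 * (Real.exp 18 * E) := by gcongr
      _ = _ := by ring
  have t3 : 2 * (p : ℝ) * (q * (Cα * μ ^ p * E⁻¹ * T)) ≤ 4 * Cα * (T ^ 2 * E) := by
    calc 2 * (p : ℝ) * (q * (Cα * μ ^ p * E⁻¹ * T))
        = 2 * (p * q) * (Cα * E⁻¹ * T) * μ ^ p := by ring
      _ ≤ 2 * (2 * T) * (Cα * E⁻¹ * T) * (E * E) := by gcongr
      _ = _ := by field_simp; ring
  linarith

/-- Segments of logarithmic length obey a deviation bound with arbitrary polynomial decay. -/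
theorem exists_segment_bound.{u} {Cε Cα μ κ B : ℝ} (hCε : 0 < Cε) (hCα : 0 < Cα)
    (hμ : μ ∈ Set.Ioo (0 : ℝ) 1) (hκ : 0 < κ) (hB : 0 < B) :
    ∃ K : ℝ, 0 < K ∧ ∃ N : ℝ, 0 < N ∧ ∀ᶠ T : ℕ in atTop,
      ∀ {Ω : Type u} [MeasurableSpace Ω] (P : Measure Ω) [IsProbabilityMeasure P] {n : ℕ}
        (ε : Fin n → ℤ → Ω → ℝ) (σlo σhi : ℝ), NoiseCondition P ε Cε Cα μ σlo σhi →
        ∀ (j : Fin n) (a e : ℕ), a ≤ e → e ≤ T → κ * Real.log T ^ 2 ≤ (e : ℝ) - a →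
          P.real {ω | K * Real.sqrt ((e : ℝ) - a) * Real.log T
              < |∑ t ∈ Finset.Ioc a e, ε j (t : ℤ) ω|}
            ≤ N * (T : ℝ) ^ (2 - B) := by
  obtain ⟨hμ0, hμ1⟩ := hμ
  have hlμ : Real.log μ < 0 := Real.log_neg hμ0 hμ1
  -- Chosen so that p ≥ A log T gives μ^p ≤ T^(-2B).
  set A := 2 * B / -Real.log μ with hA
  have hA0 : 0 < A := div_pos (by linarith) (by linarith)
  -- Makes l·Cε ≤ 1/2 below, using p ≤ 2A log T and √L ≥ √κ log T. This is where the minimal segment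
  -- length enters.
  set a₀ := Real.sqrt κ / (4 * A * Cε) with ha₀
  have ha0 : 0 < a₀ := div_pos (Real.sqrt_pos.2 hκ) (by positivity)
  set D := 64 * Cε ^ 2 with hD
  -- The exponent l·x/p equals a₀ K log T: it pays for the exponential moments, about q D l² ≤ 2A D
  -- a₀² log T + 16, and leaves B log T.
  set K := (2 * A * D * a₀ ^ 2 + B) / a₀ with hK
  refine ⟨K, by positivity, 4 * Real.exp 16 + 2 * Real.exp 18 + 4 * Cα, by positivity, ?_⟩
  filter_upwards [eventually_log_ge 1, eventually_log_ge A⁻¹,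
    eventually_mul_log_pow_le (2 * A) 1 one_pos, eventually_ge_atTop 1]
    with T hl1 hlA hTA hT1
  intro Ω _ P _ n ε σlo σhi h j a e hae heT hlen
  set ℓ := Real.log T with hℓ
  have hT0 : (0 : ℝ) < T := by exact_mod_cast hT1
  have hT1' : (1 : ℝ) ≤ T := by exact_mod_cast hT1
  set L := e - a with hLdef
  have hLc : (L : ℝ) = (e : ℝ) - a := by rw [hLdef, Nat.cast_sub hae]
  rw [← hLc] at hlen ⊢
  have hL0 : (0 : ℝ) < L := lt_of_lt_of_le (by positivity) hlen
  have hLT : (L : ℝ) ≤ T := by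
    have : L ≤ T := by omega
    exact_mod_cast this
  have hAl : 1 ≤ A * ℓ := by
    have := mul_le_mul_of_nonneg_left hlA hA0.le
    rwa [mul_inv_cancel₀ hA0.ne'] at this
  set p := ⌈A * ℓ⌉₊ with hp
  have hpl : A * ℓ ≤ p := Nat.le_ceil _
  have hpu : (p : ℝ) ≤ 2 * A * ℓ := by
    have := Nat.ceil_lt_add_one (a := A * ℓ) (by linarith)
    linarith
  have hp1 : (1 : ℝ) ≤ p := hAl.trans hpl
  have hp1' : 1 ≤ p := by exact_mod_cast hp1
  have hpT : (p : ℝ) ≤ T := by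
    simp only [pow_one, Real.rpow_one] at hTA
    linarith
  set q := L / p + 1 with hq
  have hLpq : L ≤ p * q := by
    have := Nat.div_add_mod L p
    have h2 := Nat.mod_lt L (by omega : 0 < p)
    rw [hq, mul_add]
    omega
  have hqu : (q : ℝ) ≤ L / p + 1 := by
    rw [hq]; push_cast
    linarith [Nat.cast_div_le (α := ℝ) (m := L) (n := p)]
  have hpq : (p : ℝ) * q ≤ 2 * T := by
    have := mul_le_mul_of_nonneg_left hqu (by linarith : (0 : ℝ) ≤ p)
    rw [mul_add, mul_div_cancel₀ _ (by linarith : (p : ℝ) ≠ 0)] at this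
    linarith only [this, hLT, hpT]
  have hqT : (q : ℝ) ≤ 2 * T := by nlinarith [(Nat.cast_nonneg q : (0 : ℝ) ≤ q)]
  set s := Real.sqrt L with hs
  have hs0 : 0 < s := Real.sqrt_pos.2 hL0
  have hss : s ^ 2 = L := Real.sq_sqrt hL0.le
  have hsl : Real.sqrt κ * ℓ ≤ s := by
    rw [hs]
    refine Real.le_sqrt_of_sq_le ?_
    rwa [mul_pow, Real.sq_sqrt hκ.le]
  set l := a₀ * p / s with hl
  have hl0 : 0 ≤ l := by positivity
  have hlC : l * Cε ≤ 1 / 2 := by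
    have e1 : a₀ * (2 * A * ℓ) * Cε = 1 / 2 * (Real.sqrt κ * ℓ) := by
      rw [ha₀]; field_simp; norm_num
    rw [hl, div_mul_eq_mul_div, div_le_iff₀ hs0]
    calc a₀ * p * Cε ≤ a₀ * (2 * A * ℓ) * Cε := by gcongr
      _ ≤ 1 / 2 * s := by rw [e1]; gcongr
  have hDl : D * l ^ 2 ≤ 16 := by
    have : (l * Cε) ^ 2 ≤ (1 / 2) ^ 2 := pow_le_pow_left₀ (by positivity) hlC 2
    rw [hD]
    nlinarith
  have hR : 0 < Real.exp (B * ℓ) := Real.exp_pos _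
  have hmain := h.prob_segment_le hCε j (a + 1 : ℤ) hp1' hLpq hl0 hlC hR
    (inv_pos.2 hT0) (K * s * ℓ)
  have hev : {ω | K * s * ℓ < |∑ t ∈ Finset.Ioc a e, ε j (t : ℤ) ω|}
      = {ω | K * s * ℓ < |∑ u ∈ Finset.range L, ε j ((a + 1 : ℤ) + u) ω|} := by
    ext ω
    rw [Set.mem_ofPred_eq, Set.mem_ofPred_eq, sum_Ioc_eq_sum_range_int hae fun t => ε j t ω]
  rw [hev]
  refine hmain.trans ?_
  rw [← hD]
  have hTB : (T : ℝ) ^ (2 - B) = T ^ 2 * Real.exp (-(B * ℓ)) := by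
    rw [Real.rpow_sub hT0, Real.rpow_def_of_pos hT0 B, ← hℓ, Real.exp_neg, mul_comm ℓ B]
    norm_cast
  rw [hTB]
  refine segment_bound_arith (by positivity) hT1' hpT hpq hqT hCα.le hμ0.le hDl ?_ ?_ ?_ (ADa := 2 * A * D * a₀ ^ 2 * ℓ)
  · rw [hl, hK]; field_simp
  · have f2 : (q : ℝ) * (D * l ^ 2) ≤ (L / p + 1) * (D * l ^ 2) := by gcongr
    have f3 : (L : ℝ) / p * (D * l ^ 2) = D * a₀ ^ 2 * p := by
      rw [hl, div_pow, hss]; field_simp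
    have f4 : D * a₀ ^ 2 * p ≤ D * a₀ ^ 2 * (2 * A * ℓ) := by gcongr
    linarith only [f2, f3, f4, hDl]
  · rw [← Real.exp_add]
    nth_rewrite 1 [← Real.exp_log hμ0]
    rw [← Real.exp_nat_mul]
    refine Real.exp_le_exp.2 ?_
    have h1 : A * ℓ * -Real.log μ ≤ p * -Real.log μ :=
      mul_le_mul_of_nonneg_right hpl (by linarith only [hlμ])
    have h2 : A * -Real.log μ = 2 * B := by
      rw [hA]; exact div_mul_cancel₀ _ (by linarith only [hlμ])
    have h3 : A * ℓ * -Real.log μ = 2 * B * ℓ := by rw [← h2]; ring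
    linarith only [h1, h3]

/-- The event that some long segment of some noise process has a large sum. -/
def noiseBad {Ω : Type*} {n : ℕ} (ε : Fin n → ℤ → Ω → ℝ) (κ K : ℝ) (T : ℕ) : Set Ω :=
  {ω | ∃ (j : Fin n) (a e : ℕ), a ≤ e ∧ e ≤ T ∧ κ * Real.log T ^ 2 ≤ (e : ℝ) - a ∧
    K * Real.sqrt ((e : ℝ) - a) * Real.log T < |∑ t ∈ Finset.Ioc a e, ε j (t : ℤ) ω|}

theorem exists_noiseBad_tendsto {Cε Cα μ κ w : ℝ} (hCε : 0 < Cε) (hCα : 0 < Cα)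
    (hμ : μ ∈ Set.Ioo (0 : ℝ) 1) (hκ : 0 < κ) (hw : 0 ≤ w) :
    ∃ K : ℝ, 0 < K ∧
      ∀ (Ω : ℕ → Type*) [∀ T, MeasurableSpace (Ω T)] (P : ∀ T, Measure (Ω T))
        [∀ T, IsProbabilityMeasure (P T)] (n : ℕ → ℕ) (ε : ∀ T, Fin (n T) → ℤ → Ω T → ℝ)
        (σlo σhi : ℝ), (∀ᶠ T in atTop, NoiseCondition (P T) (ε T) Cε Cα μ σlo σhi) →
        ((fun T : ℕ => (n T : ℝ)) =O[atTop] fun T : ℕ => (T : ℝ) ^ w) →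
        Tendsto (fun T => (P T).real (noiseBad (ε T) κ K T)) atTop (𝓝 0) := by
  -- There are O(T^(w+2)) triples (series, endpoints), each with probability O(T^(2-(w+5))), so the
  -- union is O(1/T).
  obtain ⟨K, hK, N, hN, hev⟩ := exists_segment_bound hCε hCα hμ hκ (by linarith : 0 < w + 5)
  refine ⟨K, hK, fun Ω _ P _ n ε σlo σhi hnoise hn => ?_⟩
  obtain ⟨C₁, hC₁, hn⟩ := hn.exists_pos
  have hlim : Tendsto (fun T : ℕ => 4 * C₁ * N * (T : ℝ)⁻¹) atTop (𝓝 0) := by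
    simpa using (tendsto_inv_atTop_nhds_zero_nat (𝕜 := ℝ)).const_mul (4 * C₁ * N)
  refine tendsto_of_tendsto_of_tendsto_of_le_of_le' tendsto_const_nhds hlim
    (Eventually.of_forall fun T => measureReal_nonneg) ?_
  filter_upwards [hev, hnoise, hn.bound, eventually_ge_atTop 1] with T hT hNC hnT hT1
  have hT0 : (0 : ℝ) < T := by exact_mod_cast hT1
  have hT1' : (1 : ℝ) ≤ T := by exact_mod_cast hT1
  rw [Real.norm_of_nonneg (by positivity), Real.norm_of_nonneg (by positivity)] at hnT
  have hsub : noiseBad (ε T) κ K T ⊆ ⋃ x ∈ (Finset.univ : Finset (Fin (n T))) ×ˢ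
      ((Finset.range (T + 1) ×ˢ Finset.range (T + 1)).filter fun y =>
        y.1 ≤ y.2 ∧ κ * Real.log T ^ 2 ≤ (y.2 : ℝ) - y.1),
      {ω | K * Real.sqrt ((x.2.2 : ℝ) - x.2.1) * Real.log T
        < |∑ t ∈ Finset.Ioc x.2.1 x.2.2, ε T x.1 (t : ℤ) ω|} := by
    rintro ω ⟨j, a, e, hae, heT, hlen, hω⟩
    refine Set.mem_biUnion (x := (j, a, e)) ?_ hω
    simp only [Finset.coe_product, Set.mem_prod, Finset.mem_coe, Finset.mem_univ, true_and,
      Finset.mem_filter, Finset.mem_product, Finset.mem_range]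
    exact ⟨⟨by omega, by omega⟩, hae, hlen⟩
  refine (measureReal_mono hsub (measure_ne_top _ _)).trans ((measureReal_biUnion_finset_le _ _).trans ?_)
  have h1 := Finset.sum_le_card_nsmul ((Finset.univ : Finset (Fin (n T))) ×ˢ
      ((Finset.range (T + 1) ×ˢ Finset.range (T + 1)).filter fun y =>
        y.1 ≤ y.2 ∧ κ * Real.log T ^ 2 ≤ (y.2 : ℝ) - y.1))
      (fun x => (P T).real {ω | K * Real.sqrt ((x.2.2 : ℝ) - x.2.1) * Real.log T
        < |∑ t ∈ Finset.Ioc x.2.1 x.2.2, ε T x.1 (t : ℤ) ω|}) (N * (T : ℝ) ^ (2 - (w + 5))) (by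
      intro x hx
      simp only [Finset.mem_product, Finset.mem_filter, Finset.mem_range] at hx
      exact hT (P T) (ε T) σlo σhi hNC x.1 x.2.1 x.2.2 hx.2.2.1 (by omega) hx.2.2.2)
  refine h1.trans ?_
  rw [nsmul_eq_mul]
  have hcard : (((Finset.univ : Finset (Fin (n T))) ×ˢ
      ((Finset.range (T + 1) ×ˢ Finset.range (T + 1)).filter fun y =>
        y.1 ≤ y.2 ∧ κ * Real.log T ^ 2 ≤ (y.2 : ℝ) - y.1)).card : ℝ)
      ≤ n T * ((T + 1) * (T + 1)) := by
    have := Finset.card_filter_le (Finset.range (T + 1) ×ˢ Finset.range (T + 1)) fun y =>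
        y.1 ≤ y.2 ∧ κ * Real.log T ^ 2 ≤ (y.2 : ℝ) - y.1
    rw [Finset.card_product, Finset.card_range] at this
    rw [Finset.card_product, Finset.card_univ, Fintype.card_fin]
    exact_mod_cast Nat.mul_le_mul_left _ this
  have hpow : (T : ℝ) ^ w * T ^ 2 * (T : ℝ) ^ (2 - (w + 5)) = (T : ℝ)⁻¹ := by
    rw [← Real.rpow_natCast, ← Real.rpow_add hT0, ← Real.rpow_add hT0, ← Real.rpow_neg_one]
    congr 1
    push_cast
    ring
  calc _ ≤ (C₁ * (T : ℝ) ^ w * ((2 * T) * (2 * T))) * (N * (T : ℝ) ^ (2 - (w + 5))) := by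
        refine mul_le_mul_of_nonneg_right (hcard.trans ?_) (by positivity)
        gcongr <;> linarith
    _ = 4 * C₁ * N * ((T : ℝ) ^ w * T ^ 2 * (T : ℝ) ^ (2 - (w + 5))) := by ring
    _ = _ := by rw [hpow]

/-! ### The double CUSUM operator as a maximum over coordinate sets -/

section Operator

variable {n : ℕ}

/-- The contrast between the coordinates in `S` and the others, with the weights of the double
CUSUM operator. -/
def contrast (m : ℕ) (S : Finset (Fin n)) (a : Fin n → ℝ) : ℝ :=
  (1 / (m : ℝ)) * ∑ j ∈ S, a j - (1 / (2 * (n : ℝ) - m)) * (∑ j, a j - ∑ j ∈ S, a j)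

/-- The scaling of the double CUSUM operator. -/
def dcScale (φ : ℝ) (n m : ℕ) : ℝ := ((m : ℝ) * (2 * n - m) / (2 * n)) ^ φ

/-- The permutation that sorts `a` decreasingly. -/
def sortDesc (a : Fin n → ℝ) : Equiv.Perm (Fin n) := Fin.revPerm.trans (Tuple.sort a)

theorem ordered_eq (a : Fin n → ℝ) (j : Fin n) : ordered a j = a (sortDesc a j) := rfl

theorem ordered_antitone (a : Fin n → ℝ) : Antitone (ordered a) := fun _ _ hij =>
  Tuple.monotone_sort a (Fin.rev_le_rev.2 hij)

/-- The coordinates of the `m` largest entries of `a`. -/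
def topSet (m : ℕ) (a : Fin n → ℝ) : Finset (Fin n) :=
  (Finset.univ.filter fun j : Fin n => j.val < m).map (sortDesc a).toEmbedding

theorem card_topSet {m : ℕ} (hm : m ≤ n) (a : Fin n → ℝ) : (topSet m a).card = m := by
  rw [topSet, Finset.card_map, Fin.card_filter_val_lt, min_eq_right hm]

/-- Trades order statistics for a set S: for fixed S the contrast is linear, and the top m entries
maximise it. -/
theorem dcOperator_eq_contrast (φ : ℝ) (m : ℕ) (a : Fin n → ℝ) :
    dcOperator φ m a = dcScale φ n m * contrast m (topSet m a) a := by
  have h1 : ∑ j ∈ topSet m a, a j = ∑ j : Fin n with j.val < m, ordered a j := by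
    rw [topSet, Finset.sum_map]; rfl
  have h2 : ∑ j, a j = ∑ j, ordered a j := (Equiv.sum_comp (sortDesc a) a).symm
  have h3 := Finset.sum_filter_add_sum_filter_not Finset.univ (fun j : Fin n => j.val < m)
    (ordered a)
  simp only [not_lt] at h3
  rw [dcOperator, dcScale, contrast, h1, h2, ← h3, add_sub_cancel_left]

theorem sum_le_sum_topSet {m : ℕ} (hm1 : 1 ≤ m) (hm : m ≤ n) (a : Fin n → ℝ)
    {S : Finset (Fin n)} (hS : S.card = m) : ∑ j ∈ S, a j ≤ ∑ j ∈ topSet m a, a j := by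
  -- The m-th largest entry, a threshold separating the top set from the rest; equal cardinalities
  -- cancel it at the end.
  set τ := ordered a ⟨m - 1, by omega⟩ with hτ
  have h1 : ∀ j, j ∈ topSet m a → τ ≤ a j := by
    intro j hj
    obtain ⟨i, hi, rfl⟩ := Finset.mem_map.1 hj
    have hi' : i.val < m := (Finset.mem_filter.1 hi).2
    exact ordered_antitone a (Fin.le_def.2 (by simp only; omega) : i ≤ ⟨m - 1, by omega⟩)
  have h2 : ∀ j, j ∉ topSet m a → a j ≤ τ := by
    intro j hj
    have hi : ¬ ((sortDesc a).symm j).val < m := fun h => hj (Finset.mem_map.2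
      ⟨(sortDesc a).symm j, Finset.mem_filter.2 ⟨Finset.mem_univ _, h⟩, by simp⟩)
    have := ordered_antitone a
      (Fin.le_def.2 (by simp only; omega) : (⟨m - 1, by omega⟩ : Fin n) ≤ (sortDesc a).symm j)
    rwa [ordered_eq a ((sortDesc a).symm j), Equiv.apply_symm_apply] at this
  have h3 : ∑ j ∈ S, (a j - τ) ≤ ∑ j ∈ topSet m a, (a j - τ) := by
    classical
    rw [← Finset.sum_inter_add_sum_sdiff S (topSet m a),
      ← Finset.sum_inter_add_sum_sdiff (topSet m a) S, Finset.inter_comm]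
    have h4 : ∑ j ∈ S \ topSet m a, (a j - τ) ≤ 0 := Finset.sum_nonpos fun j hj => by
      linarith [h2 j (Finset.mem_sdiff.1 hj).2]
    have h5 : 0 ≤ ∑ j ∈ topSet m a \ S, (a j - τ) := Finset.sum_nonneg fun j hj => by
      linarith [h1 j (Finset.mem_sdiff.1 hj).1]
    linarith
  rw [Finset.sum_sub_distrib, Finset.sum_sub_distrib, Finset.sum_const, Finset.sum_const, hS,
    card_topSet hm] at h3
  linarith

theorem contrast_le_topSet {m : ℕ} (hm1 : 1 ≤ m) (hm : m ≤ n) (a : Fin n → ℝ)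
    {S : Finset (Fin n)} (hS : S.card = m) : contrast m S a ≤ contrast m (topSet m a) a := by
  have h := sum_le_sum_topSet hm1 hm a hS
  have hm0 : (m : ℝ) ≤ n := by exact_mod_cast hm
  have hm1' : (1 : ℝ) ≤ m := by exact_mod_cast hm1
  have h1 : 0 ≤ 1 / (2 * (n : ℝ) - m) := div_nonneg one_pos.le (by linarith)
  have h2 : 0 ≤ 1 / (m : ℝ) := div_nonneg one_pos.le (by linarith)
  unfold contrast
  gcongr

theorem dcScale_nonneg (φ : ℝ) {n m : ℕ} (hm : m ≤ n) : 0 ≤ dcScale φ n m := by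
  have hm0 : (m : ℝ) ≤ n := by exact_mod_cast hm
  have : (0 : ℝ) ≤ m := Nat.cast_nonneg m
  exact Real.rpow_nonneg (div_nonneg (mul_nonneg this (by linarith)) (by linarith)) _

theorem dcScale_le {φ : ℝ} (hφ : 0 ≤ φ) {n m : ℕ} (hm1 : 1 ≤ m) (hm : m ≤ n) :
    dcScale φ n m ≤ (n : ℝ) ^ φ := by
  have hm0 : (m : ℝ) ≤ n := by exact_mod_cast hm
  have hm1' : (1 : ℝ) ≤ m := by exact_mod_cast hm1
  refine Real.rpow_le_rpow (div_nonneg (mul_nonneg (by linarith) (by linarith)) (by linarith))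
    ?_ hφ
  rw [div_le_iff₀ (by linarith)]
  nlinarith

theorem half_rpow_le_dcScale {φ : ℝ} (hφ : φ ∈ Set.Icc (0 : ℝ) 1) {n m : ℕ} (hm1 : 1 ≤ m)
    (hm : m ≤ n) : 1 / 2 * (m : ℝ) ^ φ ≤ dcScale φ n m := by
  have hm0 : (m : ℝ) ≤ n := by exact_mod_cast hm
  have hm1' : (1 : ℝ) ≤ m := by exact_mod_cast hm1
  have h1 : (1 / 2 : ℝ) ≤ (1 / 2 : ℝ) ^ φ := by
    have := Real.rpow_le_rpow_of_exponent_ge (x := (1 / 2 : ℝ)) (by norm_num) (by norm_num) hφ.2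
    rwa [Real.rpow_one] at this
  calc 1 / 2 * (m : ℝ) ^ φ ≤ (1 / 2 : ℝ) ^ φ * (m : ℝ) ^ φ := by gcongr
    _ = (1 / 2 * (m : ℝ)) ^ φ := (Real.mul_rpow (by norm_num) (by linarith)).symm
    _ ≤ dcScale φ n m := by
      refine Real.rpow_le_rpow (by linarith) ?_ hφ.1
      rw [le_div_iff₀ (by linarith)]
      nlinarith

theorem contrast_sub (m : ℕ) (S : Finset (Fin n)) (a b : Fin n → ℝ) (r : ℝ) :
    contrast m S b - r * contrast m S a = contrast m S fun j => b j - r * a j := by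
  simp only [contrast, Finset.sum_sub_distrib, ← Finset.mul_sum]
  ring

/-- The weights inside S total 1 and those outside total (n-m)/(2n-m) ≤ 1. -/
theorem contrast_le_two_mul {m : ℕ} (hm1 : 1 ≤ m) (hm : m ≤ n) {S : Finset (Fin n)}
    (hS : S.card = m) {d : Fin n → ℝ} {e : ℝ} (h1 : ∀ j ∈ S, d j ≤ e) (h2 : ∀ j ∉ S, -e ≤ d j)
    (he : 0 ≤ e) : contrast m S d ≤ 2 * e := by
  have hm0 : (m : ℝ) ≤ n := by exact_mod_cast hm
  have hm1' : (1 : ℝ) ≤ m := by exact_mod_cast hm1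
  have e1 : ∑ j ∈ S, d j ≤ m * e := by
    have := Finset.sum_le_card_nsmul S d e h1
    rwa [hS, nsmul_eq_mul] at this
  have e2 : -(n - m) * e ≤ ∑ j, d j - ∑ j ∈ S, d j := by
    rw [← Finset.sum_compl_add_sum S d, add_sub_cancel_right]
    have := Finset.card_nsmul_le_sum Sᶜ d (-e) fun j hj => h2 j (Finset.mem_compl.1 hj)
    rw [Finset.card_compl, hS, nsmul_eq_mul, Fintype.card_fin, Nat.cast_sub hm] at this
    linarith
  have e3 : 1 / (m : ℝ) * ∑ j ∈ S, d j ≤ e := by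
    rw [one_div, inv_mul_le_iff₀ (by linarith)]
    exact e1
  have e4 : -e ≤ 1 / (2 * (n : ℝ) - m) * (∑ j, d j - ∑ j ∈ S, d j) := by
    rw [one_div, le_inv_mul_iff₀ (by linarith)]
    nlinarith
  unfold contrast
  linarith

/-- The maximum over `m` of the double CUSUM operators. -/
def dcMax (φ : ℝ) (a : Fin n → ℝ) : ℝ := ⨆ m : Set.Icc 1 n, dcOperator φ (m : ℕ) a

theorem dcProfile_eq (φ : ℝ) (V : Fin n → ℝ) (x : Fin n → ℕ → ℝ) (T b : ℕ) :
    dcProfile φ V x T b = dcMax φ (absCusum V x 1 b T) := rfl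

theorem le_dcMax (φ : ℝ) {m : ℕ} (hm1 : 1 ≤ m) (hm : m ≤ n) (a : Fin n → ℝ)
    {S : Finset (Fin n)} (hS : S.card = m) : dcScale φ n m * contrast m S a ≤ dcMax φ a := by
  refine le_trans ?_ (le_ciSup (f := fun m : Set.Icc 1 n => dcOperator φ (m : ℕ) a)
    (Set.finite_range _).bddAbove ⟨m, hm1, hm⟩)
  simp only [dcOperator_eq_contrast]
  exact mul_le_mul_of_nonneg_left (contrast_le_topSet hm1 hm a hS) (dcScale_nonneg φ hm)

/-- Evaluate both vectors on the top set of `b`: linearity isolates the error, and this set is only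
a competitor for `a`. A common r for all coordinates is essential. -/
theorem dcMax_le {φ r e : ℝ} (hφ : 0 ≤ φ) (hn : 1 ≤ n) {a b : Fin n → ℝ} (hr : 0 ≤ r)
    (he : 0 ≤ e) (h : ∀ j, |b j - r * a j| ≤ e) :
    dcMax φ b ≤ r * dcMax φ a + 2 * (n : ℝ) ^ φ * e := by
  have : Nonempty (Set.Icc 1 n) := ⟨⟨1, le_rfl, hn⟩⟩
  refine ciSup_le fun ⟨m, hm1, hm⟩ => ?_
  simp only [dcOperator_eq_contrast]
  have hcard := card_topSet hm b
  have h1 : contrast m (topSet m b) b ≤ r * contrast m (topSet m b) a + 2 * e := by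
    have := contrast_le_two_mul hm1 hm hcard (d := fun j => b j - r * a j)
      (fun j _ => (abs_le.1 (h j)).2) (fun j _ => (abs_le.1 (h j)).1) he
    rw [← contrast_sub] at this
    linarith
  have h2 := le_dcMax φ hm1 hm a hcard
  have h3 := dcScale_le hφ hm1 hm
  have h0 := dcScale_nonneg φ hm
  calc _ ≤ dcScale φ n m * (r * contrast m (topSet m b) a + 2 * e) :=
        mul_le_mul_of_nonneg_left h1 h0
    _ = r * (dcScale φ n m * contrast m (topSet m b) a) + dcScale φ n m * (2 * e) := by ring
    _ ≤ r * dcMax φ a + (n : ℝ) ^ φ * (2 * e) := by gcongr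
    _ = _ := by ring

theorem numChange_le (f : Fin n → ℕ → ℝ) (η : ℕ) : numChange f η ≤ n :=
  (Finset.card_le_univ (changeSet f η)).trans_eq (Fintype.card_fin n)

theorem avgJump_nonneg (f : Fin n → ℕ → ℝ) (η : ℕ) : 0 ≤ avgJump f η :=
  mul_nonneg (by positivity) (Finset.sum_nonneg fun _ _ => abs_nonneg _)

/-- If the input of the operator follows the jumps up to an error `e`, then the maximum of the
double CUSUM operators is at least of the order of the aggregated jump size. -/
theorem dcMax_ge {φ u e : ℝ} (hφ : φ ∈ Set.Icc (0 : ℝ) 1) {f : Fin n → ℕ → ℝ} {η : ℕ}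
    (hm : 1 ≤ numChange f η) {a : Fin n → ℝ} (hu : 0 ≤ u)
    (he : 0 ≤ e) (h : ∀ j, u * |jump f η j| - e ≤ a j) (h' : ∀ j, jump f η j = 0 → a j ≤ e) :
    1 / 2 * u * ((numChange f η : ℝ) ^ φ * avgJump f η) - 2 * (n : ℝ) ^ φ * e ≤ dcMax φ a := by
  have hmn := numChange_le f η
  have hcard : (changeSet f η).card = numChange f η := rfl
  set d : Fin n → ℝ := fun j => |jump f η j| with hd
  have hd0 : ∀ j ∉ changeSet f η, d j = 0 := by
    intro j hj
    simpa [changeSet, hd] using hj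
  have hsum : ∑ j, d j = ∑ j ∈ changeSet f η, d j :=
    (Finset.sum_subset (Finset.subset_univ _) fun j _ hj => hd0 j hj).symm
  have h1 : contrast (numChange f η) (changeSet f η) d = avgJump f η := by
    rw [contrast, hsum, sub_self, mul_zero, sub_zero, one_div]
    rfl
  have h2 : u * avgJump f η - 2 * e ≤ contrast (numChange f η) (changeSet f η) a := by
    have h3 := contrast_le_two_mul hm hmn hcard (d := fun j => u * d j - 1 * a j)
      (fun j _ => by simp only [hd]; linarith [h j])
      (fun j hj => by
        have h0 : jump f η j = 0 := by simpa [changeSet] using hj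
        rw [hd0 j hj]
        linarith [h' j h0]) he
    -- Subtracting from the zero vector yields homogeneity: the contrast of u·d is u times the
    -- average jump.
    have h4 := contrast_sub (numChange f η) (changeSet f η) d (0 : Fin n → ℝ) (-u)
    have h5 := contrast_sub (numChange f η) (changeSet f η) a (fun j => u * d j) 1
    have h6 : contrast (numChange f η) (changeSet f η) (0 : Fin n → ℝ) = 0 := by simp [contrast]
    have h7 : (fun j => (0 : Fin n → ℝ) j - -u * d j) = fun j => u * d j := by ext j; simp
    rw [h6, h7, h1] at h4
    rw [← h5] at h3
    linarith
  have h3 := le_dcMax φ hm hmn a hcard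
  have h4 := half_rpow_le_dcScale hφ hm hmn
  have h5 := dcScale_le hφ.1 hm hmn
  have h0 := dcScale_nonneg φ hmn
  have h6 := avgJump_nonneg f η
  have h7 : 1 / 2 * (numChange f η : ℝ) ^ φ * (u * avgJump f η)
      ≤ dcScale φ n (numChange f η) * (u * avgJump f η) := by gcongr
  have h8 : dcScale φ n (numChange f η) * (2 * e) ≤ (n : ℝ) ^ φ * (2 * e) := by gcongr
  have h9 := mul_le_mul_of_nonneg_left h2 h0
  linarith

end Operator

/-! ### CUSUM statistics at two locations -/

theorem cusum_eq (x : ℕ → ℝ) {b T : ℕ} (hb : 1 ≤ b) (hbT : b < T) :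
    cusum x 1 b T = ((T : ℝ) * ∑ t ∈ Finset.Ioc 0 b, x t - b * ∑ t ∈ Finset.Ioc 0 T, x t)
      / Real.sqrt ((T : ℝ) * b * (T - b)) := by
  have hb0 : (0 : ℝ) < b := by exact_mod_cast hb
  have hbT0 : (0 : ℝ) < (T : ℝ) - b := sub_pos.2 (by exact_mod_cast hbT)
  have hT0 : (0 : ℝ) < T := by linarith
  set X := Real.sqrt ((T : ℝ) * b * (T - b)) with hX
  have hX0 : 0 < X := Real.sqrt_pos.2 (by positivity)
  have hXX : X ^ 2 = (T : ℝ) * b * (T - b) := Real.sq_sqrt (by positivity)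
  have e1 : Real.sqrt (((T : ℝ) - b) / ((T - (1 : ℕ) + 1) * (b - (1 : ℕ) + 1)))
      = (T - b) / X := by
    rw [← Real.sqrt_sq (by positivity : 0 ≤ ((T : ℝ) - b) / X)]
    congr 1
    rw [div_pow, hXX]
    push_cast
    rw [sub_add_cancel, sub_add_cancel]
    field_simp
  have e2 : Real.sqrt (((b : ℝ) - (1 : ℕ) + 1) / ((T - (1 : ℕ) + 1) * (T - b))) = b / X := by
    rw [← Real.sqrt_sq (by positivity : 0 ≤ (b : ℝ) / X)]
    congr 1
    rw [div_pow, hXX]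
    push_cast
    rw [sub_add_cancel, sub_add_cancel]
    field_simp
  have e3 : Finset.Icc 1 b = Finset.Ioc 0 b := rfl
  have e4 : Finset.Icc (b + 1) T = Finset.Ioc b T := by
    ext t; simp
  have e5 : ∑ t ∈ Finset.Ioc 0 T, x t
      = ∑ t ∈ Finset.Ioc 0 b, x t + ∑ t ∈ Finset.Ioc b T, x t :=
    (Finset.sum_Ioc_consecutive x (Nat.zero_le b) hbT.le).symm
  rw [cusum, e1, e2, e3, e4, e5]
  field_simp
  ring

theorem cusum_div (x : ℕ → ℝ) (v : ℝ) (s b e : ℕ) :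
    cusum (fun t => x t / v) s b e = cusum x s b e / v := by
  simp only [cusum, ← Finset.sum_div]
  ring

theorem div_mul_sqrt_le {k η : ℝ} (hk : 0 ≤ k) (hη : 0 < η) (h : k ≤ η) :
    k / η * Real.sqrt η ≤ Real.sqrt k := by
  have h1 := Real.sq_sqrt hk
  have h2 := Real.sq_sqrt hη.le
  have h3 := Real.sqrt_le_sqrt h
  have h4 := Real.sqrt_nonneg k
  have h5 : 0 < Real.sqrt η := Real.sqrt_pos.2 hη
  rw [div_mul_eq_mul_div, div_le_iff₀ hη]
  calc k * Real.sqrt η = Real.sqrt k * (Real.sqrt k * Real.sqrt η) := by nlinarith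
    _ ≤ Real.sqrt k * (Real.sqrt η * Real.sqrt η) := by gcongr
    _ = Real.sqrt k * η := by rw [← sq, h2]

/-- The bridge x - (b/η)z is small near both ends, being at most 2κ√b and, read from the other end,
at most 2κ√(η-b). Weighting the two squared bounds by η-b and b gives the product form. -/
theorem sq_bridge_le {b η κ x z : ℝ} (hb : 0 < b) (hbη : b < η) (hκ : 0 ≤ κ)
    (h1 : |x| ≤ κ * Real.sqrt b) (h2 : |z| ≤ κ * Real.sqrt η)
    (h3 : |z - x| ≤ κ * Real.sqrt (η - b)) :
    (x - b / η * z) ^ 2 ≤ 8 * κ ^ 2 * ((η - b) * b / η) := by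
  have hη : 0 < η := hb.trans hbη
  have hk : 0 < η - b := sub_pos.2 hbη
  have key : ∀ {k u w : ℝ}, 0 ≤ k → k ≤ η → |u| ≤ κ * Real.sqrt k → |w| ≤ κ * Real.sqrt η →
      (u - k / η * w) ^ 2 ≤ 4 * κ ^ 2 * k := by
    intro k u w hk0 hkη hu hw
    have e1 : |u - k / η * w| ≤ 2 * κ * Real.sqrt k := by
      have e2 : |k / η * w| ≤ κ * Real.sqrt k := by
        rw [abs_mul, abs_of_nonneg (div_nonneg hk0 hη.le)]
        calc k / η * |w| ≤ k / η * (κ * Real.sqrt η) :=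
              mul_le_mul_of_nonneg_left hw (div_nonneg hk0 hη.le)
          _ = κ * (k / η * Real.sqrt η) := by ring
          _ ≤ κ * Real.sqrt k := mul_le_mul_of_nonneg_left (div_mul_sqrt_le hk0 hη hkη) hκ
      calc |u - k / η * w| ≤ |u| + |k / η * w| := abs_sub _ _
        _ ≤ 2 * κ * Real.sqrt k := by linarith
    have e3 := pow_le_pow_left₀ (abs_nonneg _) e1 2
    rw [sq_abs, mul_pow, Real.sq_sqrt hk0] at e3
    linarith
  have f1 := key hb.le hbη.le h1 h2
  have f2 := key hk.le (by linarith) (by rwa [abs_sub_comm] at h3 : |x - z| ≤ _)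
    (by rwa [abs_neg] : |-z| ≤ _)
  have f3 : x - z - (η - b) / η * -z = x - b / η * z := by field_simp; ring
  rw [f3] at f2
  rw [← mul_div_assoc, le_div_iff₀ hη]
  nlinarith [mul_le_mul_of_nonneg_right f1 hk.le, mul_le_mul_of_nonneg_right f2 hb.le]

/-- Moving from `η` to `b < η` shrinks a CUSUM statistic with a jump at `η` by a factor `r`, up to
a noise term. -/
theorem exists_contraction_real {T b η : ℝ} (hb : 0 < b) (hbη : b < η) (hηT : η < T) :
    ∃ r y : ℝ, 0 ≤ r ∧ 0 < y ∧ y ^ 2 / 2 ≤ 1 - r ∧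
      min (η - b) (min η (T - η)) / 2 ≤ y ^ 2 * (η * (T - η) / T) ∧
      ∀ u S κ x z : ℝ, 0 ≤ κ → |x| ≤ κ * Real.sqrt b → |z| ≤ κ * Real.sqrt η →
        |z - x| ≤ κ * Real.sqrt (η - b) →
        |(T * (b * u + x) - b * S) / Real.sqrt (T * b * (T - b))
          - r * ((T * (η * u + z) - η * S) / Real.sqrt (T * η * (T - η)))| ≤ 3 * κ * y := by
  have hη : 0 < η := hb.trans hbη
  have hT : 0 < T := hη.trans hηT
  have hk : 0 < η - b := sub_pos.2 hbη
  have hTη : 0 < T - η := sub_pos.2 hηT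
  have hTb : 0 < T - b := by linarith
  set X := Real.sqrt (T * b * (T - b)) with hX
  set Y := Real.sqrt (T * η * (T - η)) with hY
  have hX0 : 0 < X := Real.sqrt_pos.2 (by positivity)
  have hY0 : 0 < Y := Real.sqrt_pos.2 (by positivity)
  have hXX : X ^ 2 = T * b * (T - b) := Real.sq_sqrt (by positivity)
  have hYY : Y ^ 2 = T * η * (T - η) := Real.sq_sqrt (by positivity)
  -- The ratio that cancels both the level u and the total sum S. Then r² = 1 - w, and y = √w
  -- measures the loss; √8 ≤ 3 gives the constant of the noise term.
  set r := b * Y / (η * X) with hr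
  set w := (η - b) * T / (η * (T - b)) with hw
  have hw0 : 0 < w := by positivity
  have hr0 : 0 ≤ r := by positivity
  have hr2 : r ^ 2 = 1 - w := by
    rw [hr, div_pow, mul_pow, mul_pow, hXX, hYY, hw]
    field_simp
    ring
  have hr1 : r ≤ 1 := by nlinarith
  have hyy : Real.sqrt w ^ 2 = w := Real.sq_sqrt hw0.le
  refine ⟨r, Real.sqrt w, hr0, Real.sqrt_pos.2 hw0, ?_, ?_, ?_⟩
  · rw [hyy]; nlinarith
  · have e : Real.sqrt w ^ 2 * (η * (T - η) / T) = (η - b) * (T - η) / (T - b) := by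
      rw [hyy, hw]; field_simp
    rw [e, div_le_div_iff₀ two_pos hTb]
    set m := min (η - b) (min η (T - η)) with hm
    have m1 : m ≤ η - b := min_le_left _ _
    have m2 : m ≤ T - η := (min_le_right _ _).trans (min_le_right _ _)
    have e2 : T - b = (η - b) + (T - η) := by ring
    rw [e2]
    nlinarith [mul_le_mul_of_nonneg_right m1 hTη.le, mul_le_mul_of_nonneg_right m2 hk.le]
  · intro u S κ x z hκ h1 h2 h3
    have e1 : (T * (b * u + x) - b * S) / X - r * ((T * (η * u + z) - η * S) / Y)
        = T * (x - b / η * z) / X := by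
      rw [hr]; field_simp; ring
    rw [e1]
    have e2 : (T * (x - b / η * z) / X) ^ 2 ≤ (3 * κ * Real.sqrt w) ^ 2 := by
      have e3 := sq_bridge_le hb hbη hκ h1 h2 h3
      have e4 : (3 * κ * Real.sqrt w) ^ 2 = 9 * κ ^ 2 * w := by rw [mul_pow, hyy]; ring
      have e5 : (T * (x - b / η * z) / X) ^ 2 = (x - b / η * z) ^ 2 * (T / (b * (T - b))) := by
        rw [div_pow, hXX]; field_simp
      have e6 : 8 * κ ^ 2 * ((η - b) * b / η) * (T / (b * (T - b))) = 8 * κ ^ 2 * w := by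
        rw [hw]; field_simp
      rw [e4, e5]
      have e7 : 0 ≤ T / (b * (T - b)) := by positivity
      have e8 := mul_le_mul_of_nonneg_right e3 e7
      rw [e6] at e8
      nlinarith [mul_nonneg (sq_nonneg κ) hw0.le]
    exact abs_le_of_sq_le_sq e2 (by positivity)

theorem sum_Ioc_add_of_const {f e : ℕ → ℝ} {a b : ℕ} {u : ℝ} (hab : a ≤ b)
    (hf : ∀ t ∈ Finset.Ioc a b, f t = u) :
    ∑ t ∈ Finset.Ioc a b, (f t + e t) = ((b : ℝ) - a) * u + ∑ t ∈ Finset.Ioc a b, e t := by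
  rw [Finset.sum_add_distrib, Finset.sum_congr rfl hf, Finset.sum_const, Nat.card_Ioc,
    nsmul_eq_mul, Nat.cast_sub hab]

/-- All segments of `e` in `(0, T]` that are longer than `L` have sums of the order of the square
root of their length. -/
def SegmentBound (e : ℕ → ℝ) (T : ℕ) (L κ : ℝ) : Prop :=
  ∀ a b : ℕ, a ≤ b → b ≤ T → L ≤ (b : ℝ) - a →
    |∑ t ∈ Finset.Ioc a b, e t| ≤ κ * Real.sqrt ((b : ℝ) - a)

theorem exists_contraction {T b η : ℕ} {L : ℝ} (hb : 1 ≤ b) (hbT : b < T) (hη : 1 ≤ η)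
    (hηT : η < T) (hL0 : 0 < L) (hLb : L ≤ b) (hLb' : L ≤ (T : ℝ) - b) (hLη : L ≤ η)
    (hLη' : L ≤ (T : ℝ) - η) (hk : L ≤ |(b : ℝ) - η|) :
    ∃ r y : ℝ, 0 ≤ r ∧ 0 < y ∧ y ^ 2 / 2 ≤ 1 - r ∧
      min |(b : ℝ) - η| (min (η : ℝ) ((T : ℝ) - η)) / 2 ≤ y ^ 2 * ((η : ℝ) * (T - η) / T) ∧
      ∀ (f e : ℕ → ℝ) (u v κ : ℝ), 0 ≤ κ → (∀ t ∈ Set.Icc 1 η, f t = u) →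
        (∀ t ∈ Set.Icc (η + 1) T, f t = v) → SegmentBound e T L κ →
        |cusum (fun t => f t + e t) 1 b T - r * cusum (fun t => f t + e t) 1 η T|
          ≤ 3 * κ * y := by
  have hb0 : (0 : ℝ) < b := by exact_mod_cast hb
  have hbT' : (b : ℝ) < T := by exact_mod_cast hbT
  have hη0 : (0 : ℝ) < η := by exact_mod_cast hη
  have hηT' : (η : ℝ) < T := by exact_mod_cast hηT
  rcases lt_trichotomy b η with hlt | heq | hgt
  · have hlt' : (b : ℝ) < η := by exact_mod_cast hlt
    have habs : |(b : ℝ) - η| = η - b := by rw [abs_sub_comm, abs_of_pos (by linarith)]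
    rw [habs] at hk ⊢
    obtain ⟨r, y, hr, hy, h1, h2, h3⟩ := exists_contraction_real hb0 hlt' hηT'
    refine ⟨r, y, hr, hy, h1, h2, fun f e u v κ hκ hu _ hseg => ?_⟩
    have s1 : ∑ t ∈ Finset.Ioc 0 b, (f t + e t) = b * u + ∑ t ∈ Finset.Ioc 0 b, e t := by
      rw [sum_Ioc_add_of_const (Nat.zero_le b) fun t ht => hu t ⟨(Finset.mem_Ioc.1 ht).1,
        (Finset.mem_Ioc.1 ht).2.trans hlt.le⟩]
      simp
    have s2 : ∑ t ∈ Finset.Ioc 0 η, (f t + e t) = η * u + ∑ t ∈ Finset.Ioc 0 η, e t := by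
      rw [sum_Ioc_add_of_const (Nat.zero_le η) fun t ht => hu t (Finset.mem_Ioc.1 ht)]
      simp
    have s3 := Finset.sum_Ioc_consecutive e (Nat.zero_le b) hlt.le
    rw [cusum_eq _ hb hbT, cusum_eq _ hη hηT, s1, s2]
    refine h3 u _ κ _ _ hκ ?_ ?_ ?_
    · simpa using hseg 0 b (Nat.zero_le b) hbT.le (by simpa using hLb)
    · simpa using hseg 0 η (Nat.zero_le η) hηT.le (by simpa using hLη)
    · rw [← s3, add_sub_cancel_left]
      exact hseg b η hlt.le hηT.le hk
  · subst heq
    rw [sub_self, abs_zero] at hk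
    linarith
  · have hgt' : (η : ℝ) < b := by exact_mod_cast hgt
    have habs : |(b : ℝ) - η| = b - η := abs_of_pos (by linarith)
    rw [habs] at hk ⊢
    -- For b > η reverse time: lengths are counted from the right end, and X and Y are unchanged.
    obtain ⟨r, y, hr, hy, h1, h2, h3⟩ := exists_contraction_real (T := (T : ℝ))
      (b := (T : ℝ) - b) (η := (T : ℝ) - η) (by linarith) (by linarith) (by linarith)
    have d1 : (T : ℝ) - η - (T - b) = b - η := by ring
    have m1 : ∀ z : ℝ, (T : ℝ) * (T - z) * z = T * z * (T - z) := fun z => by ring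
    simp only [sub_sub_cancel, d1, m1] at h2 h3
    rw [min_comm ((T : ℝ) - η), mul_comm ((T : ℝ) - η)] at h2
    refine ⟨r, y, hr, hy, h1, h2, fun f e u v κ hκ _ hv hseg => ?_⟩
    have s1 : ∑ t ∈ Finset.Ioc b T, (f t + e t) = (T - b) * v + ∑ t ∈ Finset.Ioc b T, e t :=
      sum_Ioc_add_of_const hbT.le fun t ht =>
        hv t ⟨hgt.trans (Finset.mem_Ioc.1 ht).1, (Finset.mem_Ioc.1 ht).2⟩
    have s2 : ∑ t ∈ Finset.Ioc η T, (f t + e t) = (T - η) * v + ∑ t ∈ Finset.Ioc η T, e t :=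
      sum_Ioc_add_of_const hηT.le fun t ht => hv t (Finset.mem_Ioc.1 ht)
    have s3 := Finset.sum_Ioc_consecutive e hgt.le hbT.le
    have c1 := Finset.sum_Ioc_consecutive (fun t => f t + e t) (Nat.zero_le b) hbT.le
    have c2 := Finset.sum_Ioc_consecutive (fun t => f t + e t) (Nat.zero_le η) hηT.le
    rw [cusum_eq _ hb hbT, cusum_eq _ hη hηT]
    have h4 := h3 v (∑ t ∈ Finset.Ioc 0 T, (f t + e t)) κ (∑ t ∈ Finset.Ioc b T, e t)
      (∑ t ∈ Finset.Ioc η T, e t) hκ (hseg b T hbT.le le_rfl hLb')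
      (hseg η T hηT.le le_rfl hLη') (by
        rw [← s3, add_sub_cancel_right]; exact hseg η b hgt.le hbT.le hk)
    -- A CUSUM written with suffix sums is the negative of the one with prefix sums.
    rw [← s1, ← s2, ← abs_neg] at h4
    convert h4 using 2
    rw [eq_sub_of_add_eq c1, eq_sub_of_add_eq c2]
    ring

/-- At the change-point the CUSUM statistic is the scaled jump up to a noise term. -/
theorem abs_cusum_at_change {T η : ℕ} {L : ℝ} (hη : 1 ≤ η) (hηT : η < T) (hLη : L ≤ η)
    (hLη' : L ≤ (T : ℝ) - η) {f e : ℕ → ℝ} {u v κ : ℝ} (hκ : 0 ≤ κ)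
    (hu : ∀ t ∈ Set.Icc 1 η, f t = u) (hv : ∀ t ∈ Set.Icc (η + 1) T, f t = v)
    (hseg : SegmentBound e T L κ) :
    abs (|cusum (fun t => f t + e t) 1 η T|
      - Real.sqrt ((η : ℝ) * (T - η) / T) * |v - u|) ≤ 2 * κ := by
  have hη0 : (0 : ℝ) < η := by exact_mod_cast hη
  have hTη : (0 : ℝ) < (T : ℝ) - η := sub_pos.2 (by exact_mod_cast hηT)
  have hT0 : (0 : ℝ) < T := by linarith
  set X := Real.sqrt ((T : ℝ) * η * (T - η)) with hX
  have hX0 : 0 < X := Real.sqrt_pos.2 (by positivity)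
  have hXX : X ^ 2 = (T : ℝ) * η * (T - η) := Real.sq_sqrt (by positivity)
  set h := Real.sqrt ((η : ℝ) * (T - η) / T) with hh
  have hh' : h = η * (T - η) / X := by
    rw [hh, ← Real.sqrt_sq (by positivity : 0 ≤ (η : ℝ) * (T - η) / X)]
    congr 1
    rw [div_pow, hXX]
    field_simp
  have hh0 : 0 ≤ h := Real.sqrt_nonneg _
  set x := ∑ t ∈ Finset.Ioc 0 η, e t with hx
  set z := ∑ t ∈ Finset.Ioc η T, e t with hz
  have s1 : ∑ t ∈ Finset.Ioc 0 η, (f t + e t) = η * u + x := by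
    rw [sum_Ioc_add_of_const (Nat.zero_le η) fun t ht => hu t (Finset.mem_Ioc.1 ht)]
    simp [hx]
  have s2 : ∑ t ∈ Finset.Ioc η T, (f t + e t) = (T - η) * v + z :=
    sum_Ioc_add_of_const hηT.le fun t ht => hv t (Finset.mem_Ioc.1 ht)
  have c := Finset.sum_Ioc_consecutive (fun t => f t + e t) (Nat.zero_le η) hηT.le
  have hxb : |x| ≤ κ * Real.sqrt η := by
    simpa using hseg 0 η (Nat.zero_le η) hηT.le (by simpa using hLη)
  have hzb : |z| ≤ κ * Real.sqrt (T - η) := hseg η T hηT.le le_rfl hLη'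
  have e1 : cusum (fun t => f t + e t) 1 η T = -(h * (v - u)) + ((T - η) * x - η * z) / X := by
    rw [cusum_eq _ hη hηT, ← c, s1, s2, hh', ← hX]
    field_simp
    ring
  have hmain : |((T - η) * x - η * z) / X| ≤ 2 * κ := by
    have b1 : |(T - η) * x| ≤ X * κ := by
      rw [abs_mul, abs_of_pos hTη]
      have : (T - η) * Real.sqrt η ≤ X := by
        rw [hX]
        refine Real.le_sqrt_of_sq_le ?_
        rw [mul_pow, Real.sq_sqrt hη0.le]
        nlinarith [mul_pos hTη hη0]
      calc ((T : ℝ) - η) * |x| ≤ (T - η) * (κ * Real.sqrt η) := by gcongr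
        _ = (T - η) * Real.sqrt η * κ := by ring
        _ ≤ X * κ := by gcongr
    have b2 : |η * z| ≤ X * κ := by
      rw [abs_mul, abs_of_pos hη0]
      have : η * Real.sqrt (T - η) ≤ X := by
        rw [hX]
        refine Real.le_sqrt_of_sq_le ?_
        rw [mul_pow, Real.sq_sqrt hTη.le]
        nlinarith [mul_pos hTη hη0]
      calc (η : ℝ) * |z| ≤ η * (κ * Real.sqrt (T - η)) := by gcongr
        _ = η * Real.sqrt (T - η) * κ := by ring
        _ ≤ X * κ := by gcongr
    rw [abs_div, abs_of_pos hX0, div_le_iff₀ hX0]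
    calc |(T - η) * x - η * z| ≤ |(T - η) * x| + |η * z| := abs_sub _ _
      _ ≤ 2 * κ * X := by linarith
  have e2 : h * |v - u| = |-(h * (v - u))| := by rw [abs_neg, abs_mul, abs_of_nonneg hh0]
  rw [e1, e2]
  refine (abs_abs_sub_abs_le_abs_sub _ _).trans ?_
  rw [add_sub_cancel_left]
  exact hmain

/-! ### The profile of the panel -/

section Profile

variable {n : ℕ} {φ : ℝ} {f e : Fin n → ℕ → ℝ} {η T : ℕ} {V : Fin n → ℝ} {vlo vhi L κ : ℝ}

theorem absCusum_eq (V : Fin n → ℝ) (x : Fin n → ℕ → ℝ) (s b e : ℕ) (j : Fin n) :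
    absCusum V x s b e j = |cusum (x j) s b e| / Real.sqrt (V j) := by
  rw [absCusum, cusum_div, abs_div, abs_of_nonneg (Real.sqrt_nonneg _)]

theorem dcProfile_change_ge (hφ : φ ∈ Set.Icc (0 : ℝ) 1) (hf : IsSingleChange T f η)
    (hvlo : 0 < vlo) (hV : ∀ j, vlo ≤ V j ∧ V j ≤ vhi) (hκ : 0 ≤ κ) (hLη : L ≤ η)
    (hLη' : L ≤ (T : ℝ) - η) (hseg : ∀ j, SegmentBound (e j) T L κ) :
    1 / 2 * (Real.sqrt ((η : ℝ) * (T - η) / T) / Real.sqrt vhi)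
        * ((numChange f η : ℝ) ^ φ * avgJump f η)
        - 2 * (n : ℝ) ^ φ * (2 * κ / Real.sqrt vlo)
      ≤ dcProfile φ V (fun j t => f j t + e j t) T η := by
  have hη : 1 ≤ η := hf.one_lt.le
  have hslo : 0 < Real.sqrt vlo := Real.sqrt_pos.2 hvlo
  have hsV : ∀ j, 0 < Real.sqrt (V j) ∧ Real.sqrt vlo ≤ Real.sqrt (V j) ∧
      Real.sqrt (V j) ≤ Real.sqrt vhi := fun j =>
    ⟨Real.sqrt_pos.2 (hvlo.trans_le (hV j).1), Real.sqrt_le_sqrt (hV j).1,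
      Real.sqrt_le_sqrt (hV j).2⟩
  set h := Real.sqrt ((η : ℝ) * (T - η) / T) with hh
  have hh0 : 0 ≤ h := Real.sqrt_nonneg _
  have hc : ∀ j, abs (|cusum (fun t => f j t + e j t) 1 η T| - h * |jump f η j|) ≤ 2 * κ :=
    fun j => abs_cusum_at_change hη hf.lt_T hLη hLη' hκ (hf.const_left j) (hf.const_right j)
      (hseg j)
  rw [dcProfile_eq]
  refine dcMax_ge hφ hf.one_le_numChange (by positivity) (by positivity) (fun j => ?_)
    fun j hj => ?_
  · obtain ⟨h1, h2, h3⟩ := hsV j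
    rw [absCusum_eq]
    have e1 : h / Real.sqrt vhi * |jump f η j| ≤ h * |jump f η j| / Real.sqrt (V j) := by
      rw [div_mul_eq_mul_div]
      gcongr
    have e2 : 2 * κ / Real.sqrt (V j) ≤ 2 * κ / Real.sqrt vlo := by gcongr
    have e3 : (h * |jump f η j| - 2 * κ) / Real.sqrt (V j)
        ≤ |cusum (fun t => f j t + e j t) 1 η T| / Real.sqrt (V j) := by
      gcongr
      linarith [(abs_le.1 (hc j)).1]
    rw [sub_div] at e3
    linarith
  · obtain ⟨h1, h2, h3⟩ := hsV j
    rw [absCusum_eq]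
    have e1 := (abs_le.1 (hc j)).2
    rw [hj, abs_zero, mul_zero, sub_zero] at e1
    exact div_le_div₀ (by positivity) e1 hslo h2

theorem dcProfile_contraction (hφ : 0 ≤ φ) (hf : IsSingleChange T f η) (hvlo : 0 < vlo)
    (hV : ∀ j, vlo ≤ V j) (hκ : 0 ≤ κ) {b : ℕ} (hb : 1 ≤ b) (hbT : b < T) (hL0 : 0 < L)
    (hLb : L ≤ b) (hLb' : L ≤ (T : ℝ) - b) (hLη : L ≤ η) (hLη' : L ≤ (T : ℝ) - η)
    (hk : L ≤ |(b : ℝ) - η|) (hseg : ∀ j, SegmentBound (e j) T L κ) :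
    ∃ r y : ℝ, 0 < y ∧ y ^ 2 / 2 ≤ 1 - r ∧
      min |(b : ℝ) - η| (min (η : ℝ) ((T : ℝ) - η)) / 2 ≤ y ^ 2 * ((η : ℝ) * (T - η) / T) ∧
      dcProfile φ V (fun j t => f j t + e j t) T b
        ≤ r * dcProfile φ V (fun j t => f j t + e j t) T η
          + 2 * (n : ℝ) ^ φ * (3 * κ * y / Real.sqrt vlo) := by
  have hn : 1 ≤ n := hf.one_le_numChange.trans (numChange_le f η)
  obtain ⟨r, y, hr, hy, h1, h2, h3⟩ := exists_contraction hb hbT hf.one_lt.le hf.lt_T hL0 hLb hLb'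
    hLη hLη' hk
  have hslo : 0 < Real.sqrt vlo := Real.sqrt_pos.2 hvlo
  refine ⟨r, y, hy, h1, h2, ?_⟩
  rw [dcProfile_eq, dcProfile_eq]
  refine dcMax_le hφ hn hr (by positivity) fun j => ?_
  have hs : Real.sqrt vlo ≤ Real.sqrt (V j) := Real.sqrt_le_sqrt (hV j)
  have h4 := h3 (f j) (e j) _ _ κ hκ (hf.const_left j) (hf.const_right j) (hseg j)
  rw [absCusum_eq, absCusum_eq, ← mul_div_assoc, ← sub_div, abs_div,
    abs_of_nonneg (Real.sqrt_nonneg (V j))]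
  refine div_le_div₀ (by positivity) (le_trans ?_ h4) hslo hs
  have := abs_abs_sub_abs_le_abs_sub (cusum (fun t => f j t + e j t) 1 b T)
    (r * cusum (fun t => f j t + e j t) 1 η T)
  rwa [abs_mul, abs_of_nonneg hr] at this

theorem avgJump_le {B : ℝ} (hf : IsSingleChange T f η) (hB : ∀ j, ∀ t ∈ Set.Icc 1 T, |f j t| ≤ B) :
    avgJump f η ≤ 2 * B := by
  have hm : (0 : ℝ) < numChange f η := by exact_mod_cast hf.one_le_numChange
  have h1 := hf.one_lt
  have h2 := hf.lt_T
  rw [avgJump, inv_mul_le_iff₀ hm]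
  have := Finset.sum_le_card_nsmul (changeSet f η) (fun j => |jump f η j|) (2 * B) fun j _ => by
    have b1 := hB j (η + 1) ⟨by omega, by omega⟩
    have b2 := hB j η ⟨by omega, by omega⟩
    have := abs_sub (f j (η + 1)) (f j η)
    simp only [jump]
    linarith
  rwa [nsmul_eq_mul] at this

/-- The floor in `trim` disappears because b and T - b are integers. -/
theorem mem_searchRange {C : ℝ} {b : ℕ} (hC : 0 ≤ C) :
    b ∈ searchRange C T ↔
      1 ≤ b ∧ b < T ∧ C * Real.log T ^ 2 < b ∧ C * Real.log T ^ 2 < (T : ℝ) - b := by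
  have h0 : 0 ≤ C * Real.log T ^ 2 := by positivity
  have h1 : trim C T < b ↔ C * Real.log T ^ 2 < b := Nat.floor_lt h0
  have h2 : b < T → (C * Real.log T ^ 2 < (T : ℝ) - b ↔ trim C T < T - b) := fun hb => by
    rw [trim, Nat.floor_lt h0, Nat.cast_sub hb.le]
  simp only [searchRange, Set.mem_sdiff, Set.mem_Icc, Set.mem_union, Set.mem_ofPred_eq, not_or,
    not_and, not_le]
  constructor
  · rintro ⟨⟨hb1, hbT⟩, hb2, hb3⟩
    have h3 : (b : ℝ) < T - trim C T := by
      by_contra! hcon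
      exact absurd (hb3 hcon) (not_lt.2 hbT)
    have h4 : b + trim C T < T := by
      have : (b : ℝ) + trim C T < T := by linarith
      exact_mod_cast this
    exact ⟨hb1, by omega, h1.1 (hb2 hb1), (h2 (by omega)).2 (by omega)⟩
  · rintro ⟨hb1, hbT, hb2, hb3⟩
    refine ⟨⟨hb1, hbT.le⟩, fun _ => h1.2 hb2, fun hcon => ?_⟩
    have h3 := (h2 hbT).1 hb3
    have h4 : ((b + trim C T : ℕ) : ℝ) < T := by
      have : b + trim C T < T := by omega
      exact_mod_cast this
    push_cast at h4
    linarith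

theorem dcProfile_le_testStat {C : ℝ} {b : ℕ} (x : Fin n → ℕ → ℝ) (hb : b ∈ searchRange C T) :
    dcProfile φ V x T b ≤ testStat φ C V x T := by
  have : Finite (searchRange C T) := (Set.finite_Icc 1 T).subset Set.sdiff_subset
  exact le_ciSup (f := fun b : searchRange C T => dcProfile φ V x T b)
    (Set.finite_range _).bddAbove ⟨b, hb⟩

end Profile

/-! ### The deterministic conclusion and its transfer to probability -/

set_option maxHeartbeats 1000000 in
/-- Detection and localisation on the event that the long segments of the noise have small sums and
the variance estimators are bounded away from zero and infinity. -/
theorem detection_and_localisation {n T η : ℕ} {φ C K κ c vlo vhi fbar g q W c₀ : ℝ}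
    {f e : Fin n → ℕ → ℝ} {V : Fin n → ℝ} (hφ : φ ∈ Set.Icc (0 : ℝ) 1)
    (hf : IsSingleChange T f η) (hC : 0 ≤ C) (hK : 0 < K) (hκ : 0 < κ) (hκ1 : κ ≤ 1)
    (hκC : κ ≤ C) (hc : 0 < c) (hvlo : 0 < vlo) (hvhi : 0 < vhi) (hg : 0 < g)
    (hgc : g ^ 2 = c / 2) (hW : 0 < W)
    (hV : ∀ j, vlo ≤ V j ∧ V j ≤ vhi) (hB : ∀ j, ∀ t ∈ Set.Icc 1 T, |f j t| ≤ fbar)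
    (hl : 1 ≤ Real.log T) (hη : c * W ^ 2 < min (η : ℝ) ((T : ℝ) - η))
    (hCW : (C + 1) * Real.log T ^ 2 ≤ c * W ^ 2)
    (hq : q * ((n : ℝ) ^ φ * Real.log T) ≤ (numChange f η : ℝ) ^ φ * avgJump f η * W)
    (hq1 : 16 * K * (Real.sqrt vhi / Real.sqrt vlo) ≤ g * q)
    (hq2 : 4608 * K ^ 2 * (Real.sqrt vhi / Real.sqrt vlo) ^ 2 < c * q ^ 2) (hq0 : 0 < q)
    (hc₀ : 4608 * K ^ 2 * (Real.sqrt vhi / Real.sqrt vlo) ^ 2 < c₀) (hc₀f : 4 * fbar ^ 2 ≤ c₀)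
    (hseg : ∀ j, SegmentBound (e j) T (κ * Real.log T ^ 2) (K * Real.log T)) :
    g / (4 * Real.sqrt vhi) * ((numChange f η : ℝ) ^ φ * avgJump f η) * W
        ≤ testStat φ C V (fun j t => f j t + e j t) T ∧
      ∀ b ∈ argmaxSet φ C V (fun j t => f j t + e j t) T,
        |(b : ℝ) - η| < c₀ * rate φ f η T := by
  have hn : 1 ≤ n := hf.one_le_numChange.trans (numChange_le f η)
  have hn0 : (0 : ℝ) < n := by exact_mod_cast hn
  set ℓ := Real.log T with hℓ
  have hℓ0 : 0 < ℓ := by linarith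
  set N := (n : ℝ) ^ φ with hN
  have hN0 : 0 < N := Real.rpow_pos_of_pos hn0 _
  set Δ := (numChange f η : ℝ) ^ φ * avgJump f η with hΔ
  have hΔ0 : 0 < Δ := by
    have : 0 < Δ * W := lt_of_lt_of_le (by positivity) hq
    exact pos_of_mul_pos_left this hW.le
  have hη1 : (0 : ℝ) < η := by exact_mod_cast (Nat.zero_lt_one.trans hf.one_lt)
  have hηT : (0 : ℝ) < (T : ℝ) - η := sub_pos.2 (by exact_mod_cast hf.lt_T)
  have hT0 : (0 : ℝ) < T := by linarith
  obtain ⟨hη2, hη3⟩ := lt_min_iff.1 hη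
  have hℓ2 : 0 < ℓ ^ 2 := by positivity
  have hL : κ * ℓ ^ 2 ≤ ℓ ^ 2 := mul_le_of_le_one_left hℓ2.le hκ1
  have hLC : κ * ℓ ^ 2 ≤ C * ℓ ^ 2 := mul_le_mul_of_nonneg_right hκC hℓ2.le
  rw [add_mul, one_mul] at hCW
  have hLη : κ * ℓ ^ 2 ≤ η := by linarith only [hLC, hCW, hη2, hℓ2]
  have hLη' : κ * ℓ ^ 2 ≤ (T : ℝ) - η := by linarith only [hLC, hCW, hη3, hℓ2]
  have hηS : η ∈ searchRange C T := (mem_searchRange hC).2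
    ⟨hf.one_lt.le, hf.lt_T, by linarith only [hCW, hη2, hℓ2], by linarith only [hCW, hη3, hℓ2]⟩
  set slo := Real.sqrt vlo with hslo
  set shi := Real.sqrt vhi with hshi
  have hslo0 : 0 < slo := Real.sqrt_pos.2 hvlo
  have hshi0 : 0 < shi := Real.sqrt_pos.2 hvhi
  set h := Real.sqrt ((η : ℝ) * (T - η) / T) with hh
  have hhh : h ^ 2 = (η : ℝ) * (T - η) / T := Real.sq_sqrt (by positivity)
  have hh0 : 0 < h := Real.sqrt_pos.2 (by positivity)
  -- η(T-η)/T is at least half of min(η, T-η), which explains g² = c/2.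
  have hgW : g * W ≤ h := by
    refine Real.le_sqrt_of_sq_le ?_
    rw [mul_pow, hgc, le_div_iff₀ hT0]
    have h1 := mul_le_mul_of_nonneg_right hη2.le hηT.le
    have h2 := mul_le_mul_of_nonneg_right hη3.le hη1.le
    linarith only [h1, h2]
  have hKℓ : 0 ≤ K * ℓ := by positivity
  set x : Fin n → ℕ → ℝ := fun j t => f j t + e j t with hx
  set Dη := dcProfile φ V x T η with hDη
  have hDge : h * Δ / (4 * shi) ≤ Dη := by
    have h1 := dcProfile_change_ge hφ hf hvlo hV hKℓ hLη hLη' hseg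
    have h2 : 4 * N * (K * ℓ) / slo ≤ h * Δ / (4 * shi) := by
      have e1 : 16 * K * (shi / slo) * (N * ℓ) ≤ h * Δ := by
        calc _ ≤ g * q * (N * ℓ) := by gcongr
          _ = g * (q * (N * ℓ)) := by ring
          _ ≤ g * (Δ * W) := by gcongr
          _ = g * W * Δ := by ring
          _ ≤ h * Δ := by gcongr
      have e2 : 4 * N * (K * ℓ) / slo = 16 * K * (shi / slo) * (N * ℓ) / (4 * shi) := by
        field_simp; norm_num
      rw [e2]
      gcongr
    have h3 : 1 / 2 * (h / shi) * Δ - 2 * N * (2 * (K * ℓ) / slo)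
        = 2 * (h * Δ / (4 * shi)) - 4 * N * (K * ℓ) / slo := by field_simp; ring
    rw [← hh, h3] at h1
    linarith
  refine ⟨?_, fun b hb => ?_⟩
  · refine le_trans ?_ (hDge.trans (dcProfile_le_testStat x hηS))
    have e1 : g / (4 * shi) * Δ * W = g * W * Δ / (4 * shi) := by ring
    rw [e1]
    gcongr
  · by_contra! hcon
    have hr : rate φ f η T = N ^ 2 * ℓ ^ 2 / Δ ^ 2 := by
      rw [rate, ← hΔ, ← hℓ, mul_comm 2 φ, Real.rpow_mul hn0.le, ← hN]
      norm_cast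
      rw [div_eq_mul_inv]
      ring
    have hk : c₀ * (N ^ 2 * ℓ ^ 2) ≤ |(b : ℝ) - η| * Δ ^ 2 := by
      rw [hr, ← mul_div_assoc, div_le_iff₀ (by positivity)] at hcon
      exact hcon
    have hΔN : Δ ≤ 2 * fbar * N := by
      have h1 := avgJump_le hf hB
      have h2 := avgJump_nonneg f η
      have h3 : (numChange f η : ℝ) ^ φ ≤ N := by
        refine Real.rpow_le_rpow (Nat.cast_nonneg _) ?_ hφ.1
        exact_mod_cast numChange_le f η
      calc Δ ≤ N * (2 * fbar) := by rw [hΔ]; gcongr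
        _ = _ := by ring
    -- Bounded signals give Δ ≤ 2·fbar·N, so c₀ ≥ 4·fbar² makes c₀ times the rate at least log² T. A
    -- bad b is thus far enough from η for the noise bound on the segment between them.
    have hkL : κ * ℓ ^ 2 ≤ |(b : ℝ) - η| := by
      refine hL.trans ?_
      have h1 : Δ ^ 2 ≤ 4 * fbar ^ 2 * N ^ 2 := by
        calc Δ ^ 2 ≤ (2 * fbar * N) ^ 2 := by gcongr
          _ = _ := by ring
      have h2 : ℓ ^ 2 * Δ ^ 2 ≤ |(b : ℝ) - η| * Δ ^ 2 := by
        refine le_trans ?_ hk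
        calc ℓ ^ 2 * Δ ^ 2 ≤ ℓ ^ 2 * (4 * fbar ^ 2 * N ^ 2) := by gcongr
          _ = 4 * fbar ^ 2 * (N ^ 2 * ℓ ^ 2) := by ring
          _ ≤ c₀ * (N ^ 2 * ℓ ^ 2) := by gcongr
      exact le_of_mul_le_mul_right h2 (by positivity)
    obtain ⟨hb1, hbT, hb2, hb3⟩ := (mem_searchRange hC).1 hb.1
    obtain ⟨r, y, hy, hyr, hmin, hle⟩ := dcProfile_contraction (V := V) hφ.1 hf hvlo
      (fun j => (hV j).1) hKℓ hb1 hbT (by positivity) (hLC.trans hb2.le) (hLC.trans hb3.le)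
      hLη hLη' hkL hseg
    have hmax := hb.2 η hηS
    rw [← hx, ← hDη] at hle
    rw [← hDη] at hmax
    -- 4608 = 2·48²: here 48 = 2·3·8 compares the noise 6NKℓy/slo with the gain (y²/2)·hΔ/(4·shi),
    -- and the 2 comes from the half in `hmin`.
    set G := 4608 * K ^ 2 * (shi / slo) ^ 2 with hG
    have hNℓ : 0 < N ^ 2 * ℓ ^ 2 := by positivity
    have hGmin : G * (N ^ 2 * ℓ ^ 2)
        < min |(b : ℝ) - η| (min (η : ℝ) ((T : ℝ) - η)) * Δ ^ 2 := by
      rcases min_choice |(b : ℝ) - η| (min (η : ℝ) ((T : ℝ) - η)) with hm | hm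
      · rw [hm]
        exact lt_of_lt_of_le (mul_lt_mul_of_pos_right hc₀ hNℓ) hk
      · rw [hm]
        calc G * (N ^ 2 * ℓ ^ 2) < c * q ^ 2 * (N ^ 2 * ℓ ^ 2) :=
              mul_lt_mul_of_pos_right hq2 hNℓ
          _ = c * (q * (N * ℓ)) ^ 2 := by ring
          _ ≤ c * (Δ * W) ^ 2 := by gcongr
          _ = c * W ^ 2 * Δ ^ 2 := by ring
          _ ≤ _ := by gcongr
    have hyh : 48 * K * (shi / slo) * (N * ℓ) < y * h * Δ := by
      refine lt_of_pow_lt_pow_left₀ 2 (by positivity) ?_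
      have e1 : (48 * K * (shi / slo) * (N * ℓ)) ^ 2 = G * (N ^ 2 * ℓ ^ 2) / 2 := by
        rw [hG]; ring
      have e2 : (y * h * Δ) ^ 2 = y ^ 2 * ((η : ℝ) * (T - η) / T) * Δ ^ 2 := by
        rw [mul_pow, mul_pow, hhh]
      rw [e1, e2]
      have := mul_le_mul_of_nonneg_right hmin (sq_nonneg Δ)
      linarith
    have hfin : 2 * N * (3 * (K * ℓ) * y / slo) < (1 - r) * Dη := by
      calc 2 * N * (3 * (K * ℓ) * y / slo)
          = y / (8 * shi) * (48 * K * (shi / slo) * (N * ℓ)) := by field_simp; norm_num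
        _ < y / (8 * shi) * (y * h * Δ) := mul_lt_mul_of_pos_left hyh (by positivity)
        _ = y ^ 2 / 2 * (h * Δ / (4 * shi)) := by field_simp; norm_num
        _ ≤ (1 - r) * Dη := by
          refine mul_le_mul hyr hDge (by positivity) ?_
          exact le_trans (by positivity) hyr
    linarith

theorem segmentBound_of_notMem_noiseBad {Ω : Type*} {n T : ℕ} {ε : Fin n → ℤ → Ω → ℝ} {κ K : ℝ}
    {ω : Ω} (h : ω ∉ noiseBad ε κ K T) (j : Fin n) :
    SegmentBound (fun t => ε j (t : ℤ) ω) T (κ * Real.log T ^ 2) (K * Real.log T) := by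
  intro a e hae heT hlen
  by_contra! hcon
  exact h ⟨j, a, e, hae, heT, hlen, lt_of_eq_of_lt (by ring) hcon⟩

/-- Only monotonicity and subadditivity are used, so the final event need not be shown measurable.
-/
theorem tendsto_measureReal_one {Ω : ℕ → Type*} [∀ T, MeasurableSpace (Ω T)]
    {P : ∀ T, Measure (Ω T)} [∀ T, IsProbabilityMeasure (P T)] {A B E : ∀ T, Set (Ω T)}
    (hA : Tendsto (fun T => (P T).real (A T)) atTop (𝓝 1))
    (hB : Tendsto (fun T => (P T).real (B T)) atTop (𝓝 0))
    (h : ∀ᶠ T in atTop, A T ⊆ E T ∪ B T) :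
    Tendsto (fun T => (P T).real (E T)) atTop (𝓝 1) := by
  refine tendsto_of_tendsto_of_tendsto_of_le_of_le' (by simpa using hA.sub hB)
    (tendsto_const_nhds (x := (1 : ℝ))) ?_ (Eventually.of_forall fun T => measureReal_le_one)
  filter_upwards [h] with T hT
  have := (measureReal_mono (μ := P T) hT).trans (measureReal_union_le _ _)
  linarith

end DoubleCusum

end

theorem theorem2
    (φ : ℝ) (hφ : φ ∈ Set.Icc (0 : ℝ) 1)
    -- the fixed constants of the assumptions and of the trimming
    (Cε Cα μ σlo σhi ω' fbar c β C : ℝ)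
    (hCε : 0 < Cε) (hCα : 0 < Cα) (hμ : μ ∈ Set.Ioo (0 : ℝ) 1)
    (hσlo : 0 < σlo) (hσ : σlo ≤ σhi) (hω' : 0 ≤ ω') (hfbar : 0 < fbar)
    (hc : 0 < c) (hβ : β ∈ Set.Ioc (0 : ℝ) 1) (hC : 0 < C) :
    ∃ C'' : ℝ, 0 < C'' ∧ ∃ c₀ : ℝ, 0 < c₀ ∧
      -- the panel of dimension `n T` and length `T`, for each `T`
      ∀ (Ω : ℕ → Type*) [∀ T, MeasurableSpace (Ω T)]
        (P : ∀ T, Measure (Ω T)) [∀ T, IsProbabilityMeasure (P T)]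
        (n : ℕ → ℕ)
        (f : ∀ T, Fin (n T) → ℕ → ℝ) (η : ℕ → ℕ)
        (ε : ∀ T, Fin (n T) → ℤ → Ω T → ℝ)
        -- `V T j` is the estimator of the long-run variance of `ε T j`
        (V : ∀ T, Fin (n T) → Ω T → ℝ)
        (C' : ℝ) (π : ℕ → ℝ),
        (∀ᶠ T in atTop, DoubleCusum.IsSingleChange T (f T) (η T)) →
        -- stationarity, moments, mixing and long-run variances of the noise
        (∀ᶠ T in atTop, DoubleCusum.NoiseCondition (P T) (ε T) Cε Cα μ σlo σhi) →
        -- polynomial growth of the dimension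
        ((fun T : ℕ => (n T : ℝ)) =Θ[atTop] fun T : ℕ => (T : ℝ) ^ ω') →
        -- bounded signals
        (∀ᶠ T in atTop, ∀ j, ∀ t ∈ Set.Icc 1 T, |f T j t| ≤ fbar) →
        -- distance of the change-point from the ends
        (∀ᶠ T : ℕ in atTop, c * (T : ℝ) ^ β < min (η T : ℝ) ((T : ℝ) - η T)) →
        -- size of the change
        Tendsto (fun T : ℕ => ((n T : ℝ) ^ φ * Real.log T)⁻¹ *
            ((DoubleCusum.numChange (f T) (η T) : ℝ) ^ φ * DoubleCusum.avgJump (f T) (η T)) *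
            (T : ℝ) ^ (β / 2)) atTop atTop →
        -- quality of the variance estimators
        (∀ T j, Measurable (V T j)) →
        Tendsto (fun T => (P T).real
            {ω | ∀ j, |V T j ω - DoubleCusum.longRunVar (P T) (ε T j)| ≤ σlo ^ 2 / 2})
          atTop (𝓝 1) →
        -- the range of the test criterion
        0 < C' →
        (∀ᶠ T : ℕ in atTop, C' * (n T : ℝ) ^ φ * Real.log T < π T ∧
          π T < C'' * ((DoubleCusum.numChange (f T) (η T) : ℝ) ^ φ *
            DoubleCusum.avgJump (f T) (η T)) * (T : ℝ) ^ (β / 2)) →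
        Tendsto (fun T => (P T).real
            {ω | π T < DoubleCusum.testStat φ C (fun j => V T j ω)
                  (DoubleCusum.panel (f T) (ε T) ω) T ∧
              ∀ b ∈ DoubleCusum.argmaxSet φ C (fun j => V T j ω)
                  (DoubleCusum.panel (f T) (ε T) ω) T,
                |(b : ℝ) - η T| < c₀ * DoubleCusum.rate φ (f T) (η T) T})
          atTop (𝓝 1) := by
  -- κ ≤ C makes every segment cut off by the search range long enough; κ ≤ 1 serves the segment
  -- between b and η.
  set κ := min 1 C with hκ
  have hκ0 : 0 < κ := lt_min one_pos hC
  obtain ⟨K, hK, hbad⟩ :=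
    DoubleCusum.exists_noiseBad_tendsto (w := ω') hCε hCα hμ hκ0 hω'
  set vlo := σlo ^ 2 / 2 with hvlo
  set vhi := σhi ^ 2 + σlo ^ 2 / 2 with hvhi
  have hvlo0 : 0 < vlo := by positivity
  have hvhi0 : 0 < vhi := by positivity
  set g := Real.sqrt (c / 2) with hg
  have hg0 : 0 < g := Real.sqrt_pos.2 (by positivity)
  have hgc : g ^ 2 = c / 2 := Real.sq_sqrt (by positivity)
  set s := Real.sqrt vhi / Real.sqrt vlo with hs
  have hs0 : 0 < s := div_pos (Real.sqrt_pos.2 hvhi0) (Real.sqrt_pos.2 hvlo0)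
  set G := 4608 * K ^ 2 * s ^ 2 with hG
  have hG0 : 0 < G := by positivity
  -- A fixed lower bound that the diverging ratio in (A5) eventually exceeds: the first entry serves
  -- detection, the second excludes maximisers far from η.
  set q := max (16 * K * s / g) (Real.sqrt ((G + 1) / c)) with hq
  have hq0 : 0 < q := lt_max_of_lt_left (by positivity)
  have hq1 : 16 * K * s ≤ g * q := by
    rw [mul_comm g, ← div_le_iff₀ hg0]
    exact le_max_left _ _
  have hq2 : G < c * q ^ 2 := by
    have h1 : (G + 1) / c ≤ q ^ 2 := by
      rw [← Real.sq_sqrt (by positivity : 0 ≤ (G + 1) / c)]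
      exact pow_le_pow_left₀ (Real.sqrt_nonneg _) (le_max_right _ _) 2
    rw [div_le_iff₀ hc] at h1
    linarith
  refine ⟨g / (4 * Real.sqrt vhi), by positivity, max (G + 1) (4 * fbar ^ 2),
    lt_max_of_lt_left (by positivity), ?_⟩
  intro Ω _ P _ n f η ε V C' π hSC hNC hn hf hη hsize _ hVP _ hπ
  have hnoise := hbad Ω P n ε σlo σhi hNC hn.isBigO
  refine DoubleCusum.tendsto_measureReal_one hVP hnoise ?_
  filter_upwards [hSC, hNC, hf, hη, hsize.eventually_ge_atTop q, hπ,
    DoubleCusum.eventually_log_ge 1,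
    DoubleCusum.eventually_mul_log_pow_le ((C + 1) / c) 2 hβ.1, eventually_ge_atTop 1]
    with T hSC hNC hf hη hsize hπ hl hlog hT1 ω hω
  by_cases hωb : ω ∈ DoubleCusum.noiseBad (ε T) κ K T
  · exact Or.inr hωb
  left
  have hT0 : (0 : ℝ) < T := by exact_mod_cast hT1
  have hn0 : (0 : ℝ) < n T := by
    exact_mod_cast lt_of_lt_of_le Nat.zero_lt_one
      (hSC.one_le_numChange.trans (DoubleCusum.numChange_le (f T) (η T)))
  have hNl : 0 < (n T : ℝ) ^ φ * Real.log T :=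
    mul_pos (Real.rpow_pos_of_pos hn0 _) (by linarith)
  have hW0 : 0 < (T : ℝ) ^ (β / 2) := Real.rpow_pos_of_pos hT0 _
  have hWW : ((T : ℝ) ^ (β / 2)) ^ 2 = (T : ℝ) ^ β := by
    rw [← Real.rpow_natCast, ← Real.rpow_mul hT0.le]
    congr 1
    push_cast
    ring
  obtain ⟨h1, h2⟩ := DoubleCusum.detection_and_localisation (q := q) (κ := κ) (K := K)
    (V := fun j => V T j ω) (e := fun j t => ε T j (t : ℤ) ω) (W := (T : ℝ) ^ (β / 2))
    (c₀ := max (G + 1) (4 * fbar ^ 2)) hφ hSC hC.le hK hκ0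
    (min_le_left _ _) (min_le_right _ _) hc hvlo0 hvhi0 hg0 hgc hW0
    (fun j => by
      have := abs_le.1 (hω j)
      have b1 := hNC.lrv_lower j
      have b2 := hNC.lrv_upper j
      constructor <;> simp only [hvlo, hvhi] <;> linarith)
    hf hl (by rw [hWW]; exact hη)
    (by
      rw [hWW]
      rwa [div_mul_eq_mul_div, div_le_iff₀ hc, mul_comm _ c] at hlog)
    (by
      rw [mul_assoc, inv_mul_eq_div, le_div_iff₀ hNl] at hsize
      exact hsize)
    hq1 hq2 hq0 (lt_max_of_lt_left (lt_add_one G)) (le_max_right _ _)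
    (DoubleCusum.segmentBound_of_notMem_noiseBad hωb)
  exact ⟨hπ.2.trans_le h1, h2⟩
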